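/- Let $X$ be a complex Banach space. A bounded operator $T$ on $X$ is nuclear, $T\in\mathfrak S_1(X)$, if $T=\sum_n f_n\otimes x_n$ with $f_n\in X^*$, $x_n\in X$, $\sum_n\|f_n\|\,\|x_n\|<\infty$; if $X$ has the approximation property, its trace $\mathrm{tr}(T)=\sum_n f_n(x_n)$ is well defined. Let $\mathcal{NP}(X)$ be the class of closed, densely defined operators $A$ on $X$ such that $(0,\infty)\subset\rho(A)$ and $\sup_{t>0}\|tR(t,A)\|<\infty$, where $R(t,A)=(tI-A)^{-1}$. For $A\in\mathcal{NP}(X)$ and $\lambda>0$ let $\psi_\lambda(A)$, where $\psi_\lambda(s)=\log\lambda-\log(\lambda-s)$, be the closure of the operator $x\mapsto\int_\lambda^\infty AR(t,A)x\,\frac{dt}{t}$ with domain $D(A)$. Assume that $X$ has the approximation property, that $A,B\in\mathcal{NP}(X)$, $A\neq B$, $D(A)\subseteq D(B)$, and that $B-A$ is nuclear (i.e. extends from $D(A)$ to a nuclear operator on $X$). Assume also that $\mathrm{tr}(N)=0$ for every nilpotent nuclear operator $N$ on $X$. For $\lambda>0$ put $$\Delta_{B/A}(\lambda)=\exp\bigl(\mathrm{tr}(\psi_\lambda(B)-\psi_\lambda(A))\bigr),$$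 the trace being that of the nuclear extension of $\psi_\lambda(B)-\psi_\lambda(A)$ to $X$. Let $\Omega$ be the connected component of $\rho(A)\cap\rho(B)$ that contains $(0,\infty)$. Let $z_1\in\overline{\Omega}$ be a regular point of $B$ (put then $k_0=0$) or an isolated point of the spectrum of $B$ that is an eigenvalue of finite algebraic multiplicity $k_0$, and likewise a regular point of $A$ (put then $k=0$) or an isolated point of the spectrum of $A$ that is an eigenvalue of finite algebraic multiplicity $k$; the algebraic multiplicity is the rank of the Riesz projection $\frac1{2\pi i}\oint_{|z-z_1|=r}R(z,\cdot)\,dz$ for small $r>0$. Then $\Delta_{B/A}$ has an analytic continuation from $(0,\infty)$ to $\Omega$ (necessarily unique), and this continuation is meromorphic at $z_1$ of order $k-k_0$: it has at $z_1$ a pole of order $k_0-k$ if $k_0>k$, a zero of order $k-k_0$ if $k>k_0$, and a finite nonzero limit if $k=k_0$. -/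

import Mathlib

open MeasureTheory Set

noncomputable section

namespace PertDet

section Basic

variable {X : Type*} [NormedAddCommGroup X] [NormedSpace ℂ X]

/-- The approximation property: the identity is a uniform limit, on every compact set, of bounded
operators of finite rank. -/
def HasApproximationProperty (X : Type*) [NormedAddCommGroup X] [NormedSpace ℂ X] : Prop :=
  ∀ K : Set X, IsCompact K → ∀ ε : ℝ, 0 < ε →
    ∃ T : X →L[ℂ] X, FiniteDimensional ℂ T.range ∧ ∀ x ∈ K, ‖T x - x‖ < ε

/-- `T = ∑ₙ fₙ ⊗ xₙ`, a series of operators of rank at most one which converges absolutely in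
operator norm (note `‖fₙ ⊗ xₙ‖ = ‖fₙ‖ ‖xₙ‖`). -/
def IsNuclearRep (T : X →L[ℂ] X) (r : ℕ → (X →L[ℂ] ℂ) × X) : Prop :=
  (Summable fun n => ‖(r n).1‖ * ‖(r n).2‖) ∧ HasSum (fun n => (r n).1.smulRight (r n).2) T

/-- Nuclear operators. -/
def IsNuclear (T : X →L[ℂ] X) : Prop :=
  ∃ r : ℕ → (X →L[ℂ] ℂ) × X, IsNuclearRep T r

open Classical in
/-- The trace `∑ₙ fₙ(xₙ)` of a nuclear operator `∑ₙ fₙ ⊗ xₙ`. If the space has the approximation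
property, the value does not depend on the representation. -/
def nuclearTrace (T : X →L[ℂ] X) : ℂ :=
  if h : IsNuclear T then ∑' n, (h.choose n).1 (h.choose n).2 else 0

/-- `T` is an everywhere defined bounded operator that extends the densely defined operator `S`
(there is at most one such `T`). -/
def IsBoundedExtension (S : X →ₗ.[ℂ] X) (T : X →L[ℂ] X) : Prop :=
  Dense (S.domain : Set X) ∧ ∀ x : S.domain, T x = S x

/-- A densely defined operator is regarded as nuclear if its bounded extension is. -/
def IsNuclearPMap (S : X →ₗ.[ℂ] X) : Prop :=
  ∃ T : X →L[ℂ] X, IsBoundedExtension S T ∧ IsNuclear T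

open Classical in
/-- The trace of (the bounded extension of) a densely defined nuclear operator. -/
def pmapTrace (S : X →ₗ.[ℂ] X) : ℂ :=
  if h : IsNuclearPMap S then nuclearTrace h.choose else 0

/-- `R` is a bounded two-sided inverse of `z I - A : D(A) → X`. -/
def IsResolventAt (A : X →ₗ.[ℂ] X) (z : ℂ) (R : X →L[ℂ] X) : Prop :=
  (∀ x : X, ∃ h : R x ∈ A.domain, z • R x - A ⟨R x, h⟩ = x) ∧
    ∀ x : A.domain, R (z • (x : X) - A x) = x

/-- The resolvent set `ρ(A)`. -/
def rho (A : X →ₗ.[ℂ] X) : Set ℂ :=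
  {z | ∃ R : X →L[ℂ] X, IsResolventAt A z R}

open Classical in
/-- The resolvent `R(z, A) = (z I - A)⁻¹` for `z ∈ ρ(A)`. -/
def res (z : ℂ) (A : X →ₗ.[ℂ] X) : X →L[ℂ] X :=
  if h : z ∈ rho A then h.choose else 0

/-- The class `NP(X)` of operators that are nonpositive in the sense of Komatsu. -/
structure IsNonpositive (A : X →ₗ.[ℂ] X) : Prop where
  closed : A.IsClosed
  dense_domain : Dense (A.domain : Set X)
  pos_mem_rho : ∀ t : ℝ, 0 < t → (t : ℂ) ∈ rho A
  bounded : ∃ M : ℝ, ∀ t : ℝ, 0 < t → ‖(t : ℂ) • res (t : ℂ) A‖ ≤ M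

open Classical in
/-- `A y` for `y ∈ D(A)`. -/
def applyAt (A : X →ₗ.[ℂ] X) (y : X) : X :=
  if h : y ∈ A.domain then A ⟨y, h⟩ else 0

/-- The operator `φ(A)` for `φ(s) = ∫_{(0,∞)} s / (t - s) dμ(t)`: the closure of the operator
`x ↦ ∫_{(0,∞)} A R(t, A) x dμ(t)` with domain `D(A)`. For `A ∈ NP(X)` the set of pairs below is
already a subspace, the graph of a closable operator, so the span only serves to name it as one. -/
def hirsch (μ : Measure ℝ) (A : X →ₗ.[ℂ] X) : X →ₗ.[ℂ] X :=
  (Submodule.span ℂ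
    {p : X × X | p.1 ∈ A.domain ∧
      p.2 = ∫ t in Ioi (0 : ℝ), applyAt A (res (t : ℂ) A p.1) ∂μ}).topologicalClosure.toLinearPMap

/-- The representing measure `1_{t > l} dt / t` of `ψ_l(s) = log l - log (l - s)`. -/
def psiMeasure (l : ℝ) : Measure ℝ :=
  (volume.restrict (Ioi l)).withDensity fun t => ENNReal.ofReal t⁻¹

/-- `ψ_l(A)`, where `ψ_l(s) = log l - log (l - s)`. -/
def psi (l : ℝ) (A : X →ₗ.[ℂ] X) : X →ₗ.[ℂ] X :=
  hirsch (psiMeasure l) A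

/-- The perturbation determinant `Δ_{B/A}(l) = exp (tr (ψ_l(B) - ψ_l(A)))`, `l > 0`. -/
def pertDet (B A : X →ₗ.[ℂ] X) (l : ℝ) : ℂ :=
  Complex.exp (pmapTrace (psi l B - psi l A))

/-- The connected component of `ρ(A) ∩ ρ(B)` that contains the half-line `(0, ∞)`. -/
def mainComponent (B A : X →ₗ.[ℂ] X) : Set ℂ :=
  connectedComponentIn (rho A ∩ rho B) 1

/-- `F` is the analytic continuation of `Δ_{B/A}` from `(0, ∞)` to the component of
`ρ(A) ∩ ρ(B)` that contains `(0, ∞)`. -/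
def IsContinuation (B A : X →ₗ.[ℂ] X) (F : ℂ → ℂ) : Prop :=
  AnalyticOnNhd ℂ F (mainComponent B A) ∧ ∀ l : ℝ, 0 < l → F (l : ℂ) = pertDet B A l

/-- The Riesz integral `(2πi)⁻¹ ∮_{|w - z| = r} R(w, A) dw`. -/
def rieszProj (A : X →ₗ.[ℂ] X) (z : ℂ) (r : ℝ) : X →L[ℂ] X :=
  (2 * Real.pi * Complex.I : ℂ)⁻¹ • ∮ w in C(z, r), res w A

/-- `z` is an eigenvalue of `A`, an isolated point of the spectrum, and its algebraic multiplicity,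
the rank of the Riesz projection, is finite and equal to `k`. -/
def IsIsolatedEigenvalue (A : X →ₗ.[ℂ] X) (z : ℂ) (k : ℕ) : Prop :=
  (∃ x : A.domain, (x : X) ≠ 0 ∧ A x = z • (x : X)) ∧
    ∃ r : ℝ, 0 < r ∧ Metric.closedBall z r \ {z} ⊆ rho A ∧
      FiniteDimensional ℂ (rieszProj A z r).range ∧
      Module.finrank ℂ (rieszProj A z r).range = k

/-- `z` is a regular point of `A` (and then `k = 0`) or an isolated eigenvalue of `A` of finite
algebraic multiplicity `k`. -/
def HasAlgMultiplicity (A : X →ₗ.[ℂ] X) (z : ℂ) (k : ℕ) : Prop :=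
  (z ∈ rho A ∧ k = 0) ∨ IsIsolatedEigenvalue A z k

end Basic

end PertDet

end

/-! Let V be the nuclear extension of B - A. Formally Δ(z) = det((z - A) R(z, B)) = det(1 + V R(z,
B)), so that eigenvalues of A should give zeros and eigenvalues of B poles. The proof makes this
precise through the logarithmic derivative -tr(R(z, B) - R(z, A)).

On the half-line, R(t, B) - R(t, A) = R(t, B) V R(t, A) is O(t⁻²) in nuclear norm, and
`pertDet_eq_exp_integral` identifies Δ(l) with the exponential of the integral of its trace over (l,
∞). Integrals and analyticity of nuclear operators are taken in `NuclearSpace`, a quotient of an ℓ¹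
space. It embeds injectively into the bounded operators, and the trace descends to it because of the
approximation property (`tsum_apply_eq_zero`).

Since Ω may have holes, integrating the logarithmic derivative could a priori produce a multivalued
function. The remedy is to replace V by its finite rank partial sums: 1 + VₙR(z, B) has an honest
matrix determinant, single valued and analytic. The logarithmic derivatives of these determinants
converge locally uniformly (`eventually_logDeriv_det_near`), hence the determinants, normalised at
one point, converge to a single valued function on Ω (`exists_continuation_of_logDeriv_tendsto`).

Near z₁ each resolvent has a Laurent expansion with finite rank principal part ∑ (w - z₁)⁻ʲ⁻¹ DʲP, D
nilpotent. Only j = 0 contributes to the trace, namely the rank of P over w - z₁. The remainder of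
R(w, B) - R(w, A) is meromorphic in nuclear norm and analytic in operator norm, and
`exists_analyticAt_of_clm_comp` upgrades this to analyticity in nuclear norm. So the logarithmic
derivative of the continuation is (k - k₀)/(w - z₁) plus an analytic function, which gives the order
(`meromorphicOrderAt_of_logDeriv`). -/

noncomputable section

namespace PertDet

/-! ### Linear maps on ℓ¹ and a summability lemma -/

section SummableFamilies

/-- The linear map on `ℓ¹(ι)` determined by the images `u i` of the unit vectors. -/
def l1Lift {ι E : Type*} [NormedAddCommGroup E] [NormedSpace ℂ E] [CompleteSpace E]
    (u : ι → E) (hu : ∀ i, ‖u i‖ ≤ 1) : lp (fun _ : ι => ℂ) 1 →L[ℂ] E :=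
  have hn : ∀ c : lp (fun _ : ι => ℂ) 1, Summable fun i => ‖c i‖ := fun c => by
    simpa using (lp.memℓp c).summable (by norm_num)
  have hs : ∀ c : lp (fun _ : ι => ℂ) 1, Summable fun i => ‖c i • u i‖ := fun c =>
    (hn c).of_nonneg_of_le (fun _ => norm_nonneg _) fun i => by
      rw [norm_smul]; exact mul_le_of_le_one_right (norm_nonneg _) (hu i)
  LinearMap.mkContinuous
    { toFun := fun c => ∑' i, c i • u i
      map_add' := fun c d => by
        rw [← (hs c).of_norm.tsum_add (hs d).of_norm]
        simp [add_smul]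
      map_smul' := fun a c => by
        rw [RingHom.id_apply, ← (hs c).of_norm.tsum_const_smul]
        simp [mul_smul] } 1 fun c => by
      have hnorm : ‖c‖ = ∑' i, ‖c i‖ := by
        simpa using lp.norm_eq_tsum_rpow (p := 1) (by norm_num) c
      rw [one_mul, hnorm]
      refine (norm_tsum_le_tsum_norm (hs c)).trans ((hs c).tsum_le_tsum (fun i => ?_) (hn c))
      rw [norm_smul]; exact mul_le_of_le_one_right (norm_nonneg _) (hu i)

theorem l1_summable_norm {ι : Type*} (c : lp (fun _ : ι => ℂ) 1) : Summable fun i => ‖c i‖ := by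
  simpa using (lp.memℓp c).summable (by norm_num)

theorem l1Lift_hasSum {ι E : Type*} [NormedAddCommGroup E] [NormedSpace ℂ E] [CompleteSpace E]
    (u : ι → E) (hu : ∀ i, ‖u i‖ ≤ 1) (c : lp (fun _ : ι => ℂ) 1) :
    HasSum (fun i => c i • u i) (l1Lift u hu c) := by
  refine Summable.hasSum ?_
  refine Summable.of_norm ((l1_summable_norm c).of_nonneg_of_le (fun _ => norm_nonneg _) fun i => ?_)
  rw [norm_smul]; exact mul_le_of_le_one_right (norm_nonneg _) (hu i)

theorem l1Lift_single {ι E : Type*} [DecidableEq ι] [NormedAddCommGroup E] [NormedSpace ℂ E]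
    [CompleteSpace E] (u : ι → E) (hu : ∀ i, ‖u i‖ ≤ 1) (i : ι) (a : ℂ) :
    l1Lift u hu (lp.single 1 i a) = a • u i := by
  refine (l1Lift_hasSum u hu _).unique ?_
  convert hasSum_single i fun j hj => ?_ using 1
  · simp
  · simp [hj]

/-- A summable sequence of nonnegative numbers remains summable after division by the square roots
of its tails. -/
theorem summable_div_sqrt_tail {a : ℕ → ℝ} (ha : ∀ n, 0 ≤ a n) (hs : Summable a) :
    Summable fun n => a n / √(∑' k, a (k + n)) := by
  set t : ℕ → ℝ := fun n => ∑' k, a (k + n) with ht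
  have ht0 : ∀ n, 0 ≤ t n := fun n => tsum_nonneg fun k => ha _
  have hrec : ∀ n, t n = a n + t (n + 1) := fun n => by
    have := ((summable_nat_add_iff n).2 hs).tsum_eq_zero_add
    simp only [ht]
    rw [this]
    simp [add_assoc, add_comm 1 n]
  refine summable_of_sum_range_le (c := 2 * √(t 0)) (fun n => by have := ha n; positivity) fun n => ?_
  -- Here a n = t n - t (n + 1) factors as (√(t n) - √(t (n + 1))) (√(t n) + √(t (n + 1))), and the
  -- second factor is at most 2 √(t n); the bounds telescope.
  have hstep : ∀ n, a n / √(t n) ≤ 2 * √(t n) - 2 * √(t (n + 1)) := fun n => by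
    rcases (ht0 n).eq_or_lt with h | h
    · have h1 : t (n + 1) = 0 := by have := hrec n; have := ha n; have := ht0 (n + 1); linarith
      simp [← h, h1]
    · have hp : 0 < √(t n) := Real.sqrt_pos.2 h
      rw [div_le_iff₀ hp]
      have h1 := Real.mul_self_sqrt (ht0 n)
      have h2 := Real.mul_self_sqrt (ht0 (n + 1))
      have h3 := hrec n
      nlinarith [sq_nonneg (√(t n) - √(t (n + 1)))]
  calc ∑ i ∈ Finset.range n, a i / √(t i)
      ≤ ∑ i ∈ Finset.range n, (2 * √(t i) - 2 * √(t (i + 1))) := Finset.sum_le_sum fun i _ => hstep i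
    _ = 2 * √(t 0) - 2 * √(t n) := Finset.sum_range_sub' (fun i => 2 * √(t i)) n
    _ ≤ 2 * √(t 0) := by have := Real.sqrt_nonneg (t n); linarith

end SummableFamilies

/-! ### Nuclear representations and the approximation property -/

section Nuclear

variable {X : Type*} [NormedAddCommGroup X] [NormedSpace ℂ X]

/-- Expansion of a finite rank operator as a sum of dyads along a basis of its range. -/
theorem exists_dyads_of_finiteDimensional_range (T : X →L[ℂ] X)
    (hT : FiniteDimensional ℂ T.range) :
    ∃ (φ : Fin (Module.finrank ℂ T.range) → X →L[ℂ] ℂ) (e : Fin (Module.finrank ℂ T.range) → X),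
      T = ∑ j, (φ j).smulRight (e j) ∧ (T * T = T → ∀ j, φ j (e j) = 1) := by
  let b := Module.finBasis ℂ T.range
  have hmem : ∀ x, T x ∈ T.range := fun x => LinearMap.mem_range_self (T : X →ₗ[ℂ] X) x
  let T' : X →L[ℂ] T.range := T.codRestrict _ hmem
  refine ⟨fun j => (LinearMap.toContinuousLinearMap (b.coord j)).comp T', fun j => b j, ?_, ?_⟩
  · ext x
    have := congrArg (Subtype.val) (b.sum_repr (T' x))
    simp only [sum_apply, ContinuousLinearMap.smulRight_apply]
    rw [Submodule.coe_sum] at this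
    exact this.symm
  · intro h j
    have : T' (b j) = b j := by
      obtain ⟨y, hy⟩ := (b j).2
      apply Subtype.ext
      change T (b j) = b j
      rw [← hy]
      exact congrArg (fun S : X →L[ℂ] X => S y) h
    change b.coord j (T' (b j)) = 1
    rw [this]
    simp

/-- A null sequence together with 0 is compact, so some finite rank T is within ε of the identity on
it. For T a finite sum of dyads φⱼ ⊗ eⱼ, the sum of fₙ(T xₙ) is ∑ⱼ φⱼ(∑ₙ fₙ(eⱼ) xₙ) = 0, and
replacing xₙ by T xₙ costs at most ε ∑ ‖fₙ‖. -/
theorem tsum_apply_eq_zero_of_tendsto_zero (hAP : HasApproximationProperty X)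
    {f : ℕ → X →L[ℂ] ℂ} {x : ℕ → X} (hf : Summable fun n => ‖f n‖)
    (hx : Filter.Tendsto x Filter.atTop (nhds 0))
    (h0 : ∀ y, HasSum (fun n => f n y • x n) 0) : ∑' n, f n (x n) = 0 := by
  obtain ⟨C, hC⟩ : ∃ C, ∀ n, ‖x n‖ ≤ C := by
    obtain ⟨C, hC⟩ := hx.norm.bddAbove_range
    exact ⟨C, fun n => hC ⟨n, rfl⟩⟩
  have hsum : Summable fun n => f n (x n) :=
    Summable.of_norm_bounded (hf.mul_right C) fun n =>
      ((f n).le_opNorm _).trans (mul_le_mul_of_nonneg_left (hC n) (norm_nonneg _))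
  have key : ∀ ε : ℝ, 0 < ε → ‖∑' n, f n (x n)‖ ≤ ε * ∑' n, ‖f n‖ := by
    intro ε hε
    obtain ⟨T, hT, hTε⟩ := hAP _ hx.isCompact_insert_range ε hε
    obtain ⟨φ, e, hTe, -⟩ := exists_dyads_of_finiteDimensional_range T hT
    have hz : HasSum (fun n => f n (T (x n))) 0 := by
      have : HasSum (fun n => ∑ j, φ j (x n) * f n (e j)) (∑ j, φ j 0) :=
        hasSum_sum fun j _ => by
          have := (φ j).hasSum (h0 (e j))
          simpa [mul_comm] using this
      simpa [hTe] using this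
    have hd : ∑' n, f n (x n) = ∑' n, f n (x n - T (x n)) := by
      have := hsum.hasSum.sub hz
      rw [sub_zero] at this
      rw [← this.tsum_eq]
      simp
    rw [hd, ← tsum_mul_left]
    refine tsum_of_norm_bounded (hf.mul_left ε).hasSum fun n => ?_
    refine ((f n).le_opNorm _).trans ?_
    rw [mul_comm]
    refine mul_le_mul_of_nonneg_right ?_ (norm_nonneg _)
    rw [norm_sub_rev]
    exact (hTε _ (by simp)).le
  have hS : 0 ≤ ∑' n, ‖f n‖ := tsum_nonneg fun n => norm_nonneg _
  rw [← norm_le_zero_iff]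
  refine le_of_forall_pos_le_add fun δ hδ => ?_
  rw [zero_add]
  refine (key (δ / (∑' n, ‖f n‖ + 1)) (by positivity)).trans ?_
  rw [div_mul_eq_mul_div, div_le_iff₀ (by positivity)]
  nlinarith

/-- In a space with the approximation property, a nuclear representation of `0` has trace `0`. -/
theorem tsum_apply_eq_zero (hAP : HasApproximationProperty X)
    {f : ℕ → X →L[ℂ] ℂ} {x : ℕ → X} (hs : Summable fun n => ‖f n‖ * ‖x n‖)
    (h0 : ∀ y, HasSum (fun n => f n y • x n) 0) : ∑' n, f n (x n) = 0 := by
  set a : ℕ → ℝ := fun n => ‖f n‖ * ‖x n‖ with ha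
  have ha0 : ∀ n, 0 ≤ a n := fun n => by positivity
  set t : ℕ → ℝ := fun n => ∑' k, a (k + n) with ht
  have ht0 : ∀ n, 0 ≤ t n := fun n => tsum_nonneg fun k => ha0 _
  have hat : ∀ n, t n = 0 → a n = 0 := fun n h => by
    have hle := ((summable_nat_add_iff n).2 hs).le_tsum 0 (fun j _ => ha0 _)
    have : a (0 + n) ≤ t n := hle
    rw [zero_add, h] at this
    exact le_antisymm this (ha0 n)
  -- Rescale each dyad so that ‖y n‖ = √(t n) → 0 while ‖g n‖ = a n / √(t n) stays summable. A
  -- vanishing denominator forces a n = 0, where the dyad is zero anyway.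
  let g : ℕ → X →L[ℂ] ℂ := fun n => ((‖x n‖ / √(t n) : ℝ) : ℂ) • f n
  let y : ℕ → X := fun n => ((√(t n) / ‖x n‖ : ℝ) : ℂ) • x n
  have hgy : ∀ n v, g n v • y n = f n v • x n := fun n v => by
    by_cases h : a n = 0
    · rcases mul_eq_zero.1 h with h | h
      · simp [g, norm_eq_zero.1 h]
      · simp [y, norm_eq_zero.1 h]
    · have hx : ‖x n‖ ≠ 0 := fun h' => h (by simp [ha, h'])
      have hT : √(t n) ≠ 0 := fun h' => h (hat n ((Real.sqrt_eq_zero (ht0 n)).1 h'))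
      have hc : ((‖x n‖ / √(t n) : ℝ) : ℂ) * ((√(t n) / ‖x n‖ : ℝ) : ℂ) = 1 := by
        rw [← Complex.ofReal_mul, div_mul_div_cancel₀ hT, div_self hx, Complex.ofReal_one]
      simp only [g, y, smul_apply, smul_smul, smul_eq_mul]
      rw [mul_right_comm, hc, one_mul]
  have hgy' : ∀ n, g n (y n) = f n (x n) := fun n => by
    by_cases h : a n = 0
    · rcases mul_eq_zero.1 h with h | h
      · simp [g, norm_eq_zero.1 h]
      · simp [y, norm_eq_zero.1 h]
    · have hx : ‖x n‖ ≠ 0 := fun h' => h (by simp [ha, h'])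
      have hT : √(t n) ≠ 0 := fun h' => h (hat n ((Real.sqrt_eq_zero (ht0 n)).1 h'))
      have hc : ((‖x n‖ / √(t n) : ℝ) : ℂ) * ((√(t n) / ‖x n‖ : ℝ) : ℂ) = 1 := by
        rw [← Complex.ofReal_mul, div_mul_div_cancel₀ hT, div_self hx, Complex.ofReal_one]
      simp only [g, y, smul_apply, map_smul, smul_eq_mul]
      rw [mul_left_comm, ← mul_assoc, hc, one_mul]
  have := tsum_apply_eq_zero_of_tendsto_zero hAP (f := g) (x := y) ?_ ?_ ?_
  · simpa only [hgy'] using this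
  · refine (summable_div_sqrt_tail ha0 hs).congr fun n => ?_
    simp only [g, norm_smul, Complex.norm_real, Real.norm_eq_abs, abs_div, abs_norm,
      abs_of_nonneg (Real.sqrt_nonneg _)]
    simp only [ha, ht]; ring
  · rw [tendsto_zero_iff_norm_tendsto_zero]
    have h1 : Filter.Tendsto (fun n => √(t n)) Filter.atTop (nhds 0) := by
      have := (tendsto_sum_nat_add a).sqrt
      simpa using this
    refine squeeze_zero (fun _ => norm_nonneg _) (fun n => ?_) h1
    simp only [y, norm_smul, Complex.norm_real, Real.norm_eq_abs, abs_div, abs_norm,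
      abs_of_nonneg (Real.sqrt_nonneg _)]
    by_cases h : ‖x n‖ = 0
    · simp [h]
    · rw [div_mul_cancel₀ _ h]
  · simpa only [hgy] using h0

theorem IsNuclearRep.hasSum_apply {T : X →L[ℂ] X} {r : ℕ → (X →L[ℂ] ℂ) × X}
    (h : IsNuclearRep T r) (y : X) : HasSum (fun n => (r n).1 y • (r n).2) (T y) := by
  simpa using (ContinuousLinearMap.apply ℂ X y).hasSum h.2

/-- The representation of `P T Q` obtained from one of `T`. -/
def sandwichRep (r : ℕ → (X →L[ℂ] ℂ) × X) (P Q : X →L[ℂ] X) (n : ℕ) : (X →L[ℂ] ℂ) × X :=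
  ((r n).1.comp Q, P (r n).2)

theorem sandwichRep_bound (r : ℕ → (X →L[ℂ] ℂ) × X) (P Q : X →L[ℂ] X) (n : ℕ) :
    ‖(sandwichRep r P Q n).1‖ * ‖(sandwichRep r P Q n).2‖ ≤
      ‖P‖ * ‖Q‖ * (‖(r n).1‖ * ‖(r n).2‖) := by
  calc ‖(r n).1.comp Q‖ * ‖P (r n).2‖ ≤ (‖(r n).1‖ * ‖Q‖) * (‖P‖ * ‖(r n).2‖) := by
        gcongr
        · exact ContinuousLinearMap.opNorm_comp_le _ _
        · exact P.le_opNorm _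
    _ = _ := by ring

end Nuclear

/-! ### The Banach space of nuclear operators and its trace -/

section NuclearSpace

variable (X : Type*) [NormedAddCommGroup X] [NormedSpace ℂ X]

/-- Pairs of a functional and a vector, both in the unit ball. -/
abbrev UnitPair : Type _ := {p : (X →L[ℂ] ℂ) × X // ‖p.1‖ ≤ 1 ∧ ‖p.2‖ ≤ 1}

variable {X} in
theorem norm_smulRight_unitPair_le (p : UnitPair X) : ‖p.1.1.smulRight p.1.2‖ ≤ 1 := by
  rw [ContinuousLinearMap.norm_smulRight_apply]
  exact mul_le_one₀ p.2.1 (norm_nonneg _) p.2.2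

variable {X} in
theorem norm_apply_unitPair_le (p : UnitPair X) : ‖p.1.1 p.1.2‖ ≤ 1 :=
  (p.1.1.le_opNorm _).trans (mul_le_one₀ p.2.1 (norm_nonneg _) p.2.2)

variable [CompleteSpace X]

/-- The operator `∑ c(f, x) f ⊗ x` of a summable family of coefficients. -/
def l1ToOp : lp (fun _ : UnitPair X => ℂ) 1 →L[ℂ] (X →L[ℂ] X) :=
  l1Lift _ norm_smulRight_unitPair_le

/-- The sum `∑ c(f, x) f(x)` of a summable family of coefficients. -/
def l1ToTrace : lp (fun _ : UnitPair X => ℂ) 1 →L[ℂ] ℂ :=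
  l1Lift _ norm_apply_unitPair_le

/-- Needed for the quotient seminorm on `NuclearSpace` to be a norm. -/
instance isClosed_ker_l1ToOp :
    IsClosed (((l1ToOp X).ker : Submodule ℂ (lp (fun _ : UnitPair X => ℂ) 1)) :
      Set (lp (fun _ : UnitPair X => ℂ) 1)) :=
  (l1ToOp X).isClosed_ker

/-- The Banach space of nuclear operators, as a quotient of an `ℓ¹` space. -/
abbrev NuclearSpace : Type _ := lp (fun _ : UnitPair X => ℂ) 1 ⧸ (l1ToOp X).ker

variable {X}

/-- The operator that corresponds to an element of the nuclear space. -/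
def NuclearSpace.toOp : NuclearSpace X →L[ℂ] (X →L[ℂ] X) :=
  Submodule.liftQL (l1ToOp X).ker (l1ToOp X) le_rfl

/-- Immediate, as the quotient is by the kernel of the map itself. It lets identities in the nuclear
space be checked on operators, and it is what makes the trace independent of the way an operator is
written. -/
theorem NuclearSpace.toOp_injective :
    Function.Injective (NuclearSpace.toOp : NuclearSpace X → X →L[ℂ] X) := by
  refine (injective_iff_map_eq_zero _).2 fun n hn => ?_
  obtain ⟨c, rfl⟩ := Submodule.Quotient.mk_surjective _ n
  exact (Submodule.Quotient.mk_eq_zero _).2 hn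

/-- Every element of the `ℓ¹` space, having countable support, gives rise to a sequence. -/
theorem exists_isNuclearRep_l1ToOp (c : lp (fun _ : UnitPair X => ℂ) 1) :
    ∃ r : ℕ → (X →L[ℂ] ℂ) × X, IsNuclearRep (l1ToOp X c) r ∧
      HasSum (fun n => (r n).1 (r n).2) (l1ToTrace X c) := by
  have hcount : (Function.support fun p => ‖c p‖).Countable := (l1_summable_norm c).countable_support
  set s : Set (UnitPair X) := Function.support fun p => ‖c p‖ with hs
  have hout : ∀ p : UnitPair X, p ∉ range ((↑) : s → UnitPair X) → c p = 0 := fun p hp => by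
    simpa [hs] using hp
  have : Countable s := hcount.to_subtype
  obtain ⟨e, he⟩ := exists_injective_nat s
  let q : s → (X →L[ℂ] ℂ) × X := fun p => (c p.1 • p.1.1.1, p.1.1.2)
  -- The coefficient is absorbed into the functional; indices outside the enumerated support carry
  -- the zero dyad.
  let r : ℕ → (X →L[ℂ] ℂ) × X := Function.extend e q 0
  have hr : ∀ p, r (e p) = q p := fun p => he.extend_apply _ _ p
  have hr0 : ∀ n, n ∉ range e → r n = 0 := fun n hn => by
    simpa using Function.extend_apply' q (0 : ℕ → (X →L[ℂ] ℂ) × X) n (by simpa using hn)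
  have hval : Function.Injective ((↑) : s → UnitPair X) := Subtype.val_injective
  refine ⟨r, ⟨?_, ?_⟩, ?_⟩
  · refine (he.summable_iff fun n hn => by simp [hr0 n hn]).1 ?_
    refine Summable.of_nonneg_of_le (fun p => by simp only [Function.comp_apply]; positivity)
      (fun p => ?_) ((l1_summable_norm c).comp_injective hval)
    simp only [Function.comp_apply, hr, q, norm_smul]
    calc ‖c p.1‖ * ‖p.1.1.1‖ * ‖p.1.1.2‖ ≤ ‖c p.1‖ * 1 * 1 := by
          gcongr
          · exact p.1.2.1
          · exact p.1.2.2
      _ = ‖c p.1‖ := by ring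
  · refine (he.hasSum_iff fun n hn => ?_).1 ?_
    · simp only [hr0 n hn]; ext; simp
    · have h := (hval.hasSum_iff fun p hp => ?_).2
        (l1Lift_hasSum _ norm_smulRight_unitPair_le c)
      · refine h.congr_fun fun p => ?_
        simp only [Function.comp_apply, hr, q]
        ext v; simp [mul_smul]
      · simp [hout p hp]
  · refine (he.hasSum_iff fun n hn => by simp [hr0 n hn]).1 ?_
    have h := (hval.hasSum_iff fun p hp => ?_).2
        (l1Lift_hasSum _ norm_apply_unitPair_le c)
    · refine h.congr_fun fun p => ?_
      simp [hr, q]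
    · simp [hout p hp]

/-- This is where the approximation property makes the trace well defined. -/
theorem ker_l1ToOp_le_ker_l1ToTrace (hAP : HasApproximationProperty X) :
    (l1ToOp X).ker ≤ (l1ToTrace X).ker := by
  intro c hc
  obtain ⟨r, hr, hs⟩ := exists_isNuclearRep_l1ToOp c
  have hc' : l1ToOp X c = 0 := hc
  rw [hc'] at hr
  have := tsum_apply_eq_zero hAP hr.1 fun y => by simpa using hr.hasSum_apply y
  exact hs.tsum_eq.symm.trans this

/-- The trace on the nuclear space of a space with the approximation property. -/
def NuclearSpace.trace (hAP : HasApproximationProperty X) : NuclearSpace X →L[ℂ] ℂ :=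
  Submodule.liftQL (l1ToOp X).ker (l1ToTrace X) (ker_l1ToOp_le_ker_l1ToTrace hAP)

open Classical in
/-- The dyad `f ⊗ x` as an element of the nuclear space. -/
def dyad (f : X →L[ℂ] ℂ) (x : X) : NuclearSpace X :=
  -- The coefficient ‖f‖ ‖x‖ sits on the normalised pair. With 0⁻¹ = 0 the pair stays in the unit
  -- balls even if f or x vanishes, and the coefficient is then 0.
  Submodule.Quotient.mk (lp.single 1 (⟨((‖f‖⁻¹ : ℂ) • f, (‖x‖⁻¹ : ℂ) • x), by
      simpa [norm_smul] using inv_mul_le_one_of_le₀ le_rfl (norm_nonneg _), by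
      simpa [norm_smul] using inv_mul_le_one_of_le₀ le_rfl (norm_nonneg _)⟩ : UnitPair X) (‖f‖ * ‖x‖ : ℂ))

theorem toOp_dyad (f : X →L[ℂ] ℂ) (x : X) : (dyad f x).toOp = f.smulRight x := by
  classical
  refine (l1Lift_single _ norm_smulRight_unitPair_le _ _).trans ?_
  rcases eq_or_ne f 0 with rfl | hf
  · ext; simp
  rcases eq_or_ne x 0 with rfl | hx
  · ext; simp
  have hf' : (‖f‖ : ℂ) ≠ 0 := by simpa using hf
  have hx' : (‖x‖ : ℂ) ≠ 0 := by simpa using hx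
  ext v
  simp only [smul_apply, ContinuousLinearMap.smulRight_apply, smul_smul, smul_eq_mul]
  congr 1
  field_simp

theorem trace_dyad (hAP : HasApproximationProperty X) (f : X →L[ℂ] ℂ) (x : X) :
    NuclearSpace.trace hAP (dyad f x) = f x := by
  classical
  refine (l1Lift_single _ norm_apply_unitPair_le _ _).trans ?_
  rcases eq_or_ne f 0 with rfl | hf
  · simp
  rcases eq_or_ne x 0 with rfl | hx
  · simp
  have hf' : (‖f‖ : ℂ) ≠ 0 := by simpa using hf
  have hx' : (‖x‖ : ℂ) ≠ 0 := by simpa using hx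
  simp only [smul_apply, map_smul, smul_eq_mul]
  field_simp

theorem norm_dyad_le (f : X →L[ℂ] ℂ) (x : X) : ‖dyad f x‖ ≤ ‖f‖ * ‖x‖ := by
  classical
  refine (Submodule.Quotient.norm_mk_le _ _).trans ?_
  rw [lp.norm_single (by norm_num)]
  simp

/-- The element of the nuclear space given by a summable sequence of dyads. -/
def ofRep (r : ℕ → (X →L[ℂ] ℂ) × X) : NuclearSpace X :=
  ∑' n, dyad (r n).1 (r n).2

theorem hasSum_ofRep {r : ℕ → (X →L[ℂ] ℂ) × X} (h : Summable fun n => ‖(r n).1‖ * ‖(r n).2‖) :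
    HasSum (fun n => dyad (r n).1 (r n).2) (ofRep r) :=
  (Summable.of_norm_bounded h fun _ => norm_dyad_le _ _).hasSum

theorem norm_ofRep_le {r : ℕ → (X →L[ℂ] ℂ) × X} (h : Summable fun n => ‖(r n).1‖ * ‖(r n).2‖) :
    ‖ofRep r‖ ≤ ∑' n, ‖(r n).1‖ * ‖(r n).2‖ :=
  tsum_of_norm_bounded h.hasSum fun _ => norm_dyad_le _ _

theorem toOp_ofRep {T : X →L[ℂ] X} {r : ℕ → (X →L[ℂ] ℂ) × X} (h : IsNuclearRep T r) :
    (ofRep r).toOp = T := by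
  have := NuclearSpace.toOp.hasSum (hasSum_ofRep h.1)
  simp only [toOp_dyad] at this
  exact this.unique h.2

theorem hasSum_trace_ofRep (hAP : HasApproximationProperty X) {r : ℕ → (X →L[ℂ] ℂ) × X}
    (h : Summable fun n => ‖(r n).1‖ * ‖(r n).2‖) :
    HasSum (fun n => (r n).1 (r n).2) (NuclearSpace.trace hAP (ofRep r)) := by
  simpa only [trace_dyad] using (NuclearSpace.trace hAP).hasSum (hasSum_ofRep h)

theorem isNuclear_toOp (n : NuclearSpace X) : IsNuclear n.toOp := by
  obtain ⟨c, rfl⟩ := Submodule.Quotient.mk_surjective _ n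
  obtain ⟨r, hr, -⟩ := exists_isNuclearRep_l1ToOp c
  exact ⟨r, hr⟩

/-- Whatever representation `nuclearTrace` picks, it sums to an element with the same operator,
hence to n itself by injectivity. -/
theorem nuclearTrace_toOp (hAP : HasApproximationProperty X) (n : NuclearSpace X) :
    nuclearTrace n.toOp = NuclearSpace.trace hAP n := by
  have h := isNuclear_toOp n
  rw [nuclearTrace, dif_pos h, (hasSum_trace_ofRep hAP h.choose_spec.1).tsum_eq,
    NuclearSpace.toOp_injective (toOp_ofRep h.choose_spec)]

/-- A projection fixes the basis of its range, so each dyad of the expansion has trace 1. This is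
how algebraic multiplicities enter the trace. -/
theorem exists_toOp_eq_of_finiteDimensional_range (hAP : HasApproximationProperty X)
    (T : X →L[ℂ] X) (hT : FiniteDimensional ℂ T.range) :
    ∃ n : NuclearSpace X, n.toOp = T ∧
      (T * T = T → NuclearSpace.trace hAP n = Module.finrank ℂ T.range) := by
  obtain ⟨φ, e, hTe, hproj⟩ := exists_dyads_of_finiteDimensional_range T hT
  refine ⟨∑ j, dyad (φ j) (e j), ?_, fun h => ?_⟩
  · rw [map_sum]
    simp only [toOp_dyad]
    exact hTe.symm
  · rw [map_sum]
    simp [trace_dyad, hproj h]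

theorem IsNuclearRep.sandwich {T : X →L[ℂ] X} {r : ℕ → (X →L[ℂ] ℂ) × X} (h : IsNuclearRep T r)
    (P Q : X →L[ℂ] X) : IsNuclearRep (P * T * Q) (sandwichRep r P Q) := by
  have hs : Summable fun n => ‖(sandwichRep r P Q n).1‖ * ‖(sandwichRep r P Q n).2‖ :=
    Summable.of_nonneg_of_le (fun n => by positivity) (sandwichRep_bound r P Q)
      (h.1.mul_left (‖P‖ * ‖Q‖))
  refine ⟨hs, ?_⟩
  have h1 : Summable fun n => (sandwichRep r P Q n).1.smulRight (sandwichRep r P Q n).2 := by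
    refine Summable.of_norm_bounded hs fun n => ?_
    rw [ContinuousLinearMap.norm_smulRight_apply]
  convert h1.hasSum using 1
  ext v
  have h2 := (ContinuousLinearMap.apply ℂ X v).hasSum h1.hasSum
  have h3 := P.hasSum (h.hasSum_apply (Q v))
  refine h3.unique ?_
  simpa [sandwichRep] using h2

theorem norm_ofRep_sandwichRep_le {T : X →L[ℂ] X} {r : ℕ → (X →L[ℂ] ℂ) × X}
    (h : IsNuclearRep T r) (P Q : X →L[ℂ] X) :
    ‖ofRep (sandwichRep r P Q)‖ ≤ (∑' n, ‖(r n).1‖ * ‖(r n).2‖) * ‖P‖ * ‖Q‖ := by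
  refine (norm_ofRep_le (h.sandwich P Q).1).trans ?_
  refine ((h.sandwich P Q).1.tsum_le_tsum (sandwichRep_bound r P Q)
    (h.1.mul_left (‖P‖ * ‖Q‖))).trans ?_
  rw [tsum_mul_left]
  exact le_of_eq (by ring)

/-- For a nuclear operator `T`, the bounded bilinear map `(P, Q) ↦ P T Q` into the nuclear
space. -/
def sandwich {T : X →L[ℂ] X} {r : ℕ → (X →L[ℂ] ℂ) × X} (h : IsNuclearRep T r) :
    (X →L[ℂ] X) →L[ℂ] (X →L[ℂ] X) →L[ℂ] NuclearSpace X :=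
  LinearMap.mkContinuous₂
    (LinearMap.mk₂ ℂ (fun P Q => ofRep (sandwichRep r P Q))
      (fun P P' Q => NuclearSpace.toOp_injective <| by
        simp only [map_add, toOp_ofRep (h.sandwich _ _)]; noncomm_ring)
      (fun c P Q => NuclearSpace.toOp_injective <| by
        simp only [map_smul, toOp_ofRep (h.sandwich _ _)]; simp)
      (fun P Q Q' => NuclearSpace.toOp_injective <| by
        simp only [map_add, toOp_ofRep (h.sandwich _ _)]; noncomm_ring)
      (fun c P Q => NuclearSpace.toOp_injective <| by
        simp only [map_smul, toOp_ofRep (h.sandwich _ _)]; simp))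
    (∑' n, ‖(r n).1‖ * ‖(r n).2‖) (norm_ofRep_sandwichRep_le h)

theorem norm_sandwich_le {T : X →L[ℂ] X} {r : ℕ → (X →L[ℂ] ℂ) × X} (h : IsNuclearRep T r)
    (P Q : X →L[ℂ] X) :
    ‖sandwich h P Q‖ ≤ (∑' n, ‖(r n).1‖ * ‖(r n).2‖) * ‖P‖ * ‖Q‖ :=
  norm_ofRep_sandwichRep_le h P Q

theorem toOp_sandwich {T : X →L[ℂ] X} {r : ℕ → (X →L[ℂ] ℂ) × X} (h : IsNuclearRep T r)
    (P Q : X →L[ℂ] X) : (sandwich h P Q).toOp = P * T * Q :=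
  toOp_ofRep (h.sandwich P Q)

/-- Cyclicity in concrete form: the dyad (f ∘ Q) ⊗ P x has trace f(Q P x), so only the product QP
matters. -/
theorem hasSum_trace_sandwich (hAP : HasApproximationProperty X) {T : X →L[ℂ] X}
    {r : ℕ → (X →L[ℂ] ℂ) × X} (h : IsNuclearRep T r) (P Q : X →L[ℂ] X) :
    HasSum (fun n => (r n).1 (Q (P (r n).2))) (NuclearSpace.trace hAP (sandwich h P Q)) :=
  hasSum_trace_ofRep hAP (h.sandwich P Q).1

end NuclearSpace

/-! ### Resolvents and their bounded perturbations -/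

section Resolvent

variable {X : Type*} [NormedAddCommGroup X] [NormedSpace ℂ X] {A B : X →ₗ.[ℂ] X} {z w : ℂ}

theorem isResolventAt_res (hz : z ∈ rho A) : IsResolventAt A z (res z A) := by
  rw [res, dif_pos hz]
  exact hz.choose_spec

theorem res_mem_domain (hz : z ∈ rho A) (x : X) : res z A x ∈ A.domain :=
  ((isResolventAt_res hz).1 x).1

theorem apply_res (hz : z ∈ rho A) (x : X) :
    A ⟨res z A x, res_mem_domain hz x⟩ = z • res z A x - x := by
  obtain ⟨h, hx⟩ := (isResolventAt_res hz).1 x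
  rw [eq_sub_iff_add_eq, ← eq_sub_iff_add_eq']
  exact hx.symm

theorem res_apply_sub (hz : z ∈ rho A) (x : A.domain) : res z A (z • (x : X) - A x) = x :=
  (isResolventAt_res hz).2 x

theorem IsResolventAt.eq_res {R : X →L[ℂ] X} (h : IsResolventAt A z R) : R = res z A := by
  have hz : z ∈ rho A := ⟨R, h⟩
  ext x
  obtain ⟨hx, e⟩ := h.1 x
  have h' := res_apply_sub hz ⟨R x, hx⟩
  rw [e] at h'
  exact h'.symm

theorem res_injective (hz : z ∈ rho A) : Function.Injective (res z A) := by
  refine (injective_iff_map_eq_zero _).2 fun x hx => ?_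
  have h := apply_res hz x
  have h0 : (⟨res z A x, res_mem_domain hz x⟩ : A.domain) = 0 := Subtype.ext hx
  rw [h0, LinearPMap.map_zero, hx, smul_zero, zero_sub, eq_comm, neg_eq_zero] at h
  exact h

theorem res_sub_res (hz : z ∈ rho A) (hw : w ∈ rho A) :
    res z A - res w A = (w - z) • (res z A * res w A) := by
  ext x
  have h := res_apply_sub hz ⟨res w A x, res_mem_domain hw x⟩
  rw [apply_res hw x] at h
  simp only [map_sub, map_smul] at h
  simp only [sub_apply, smul_apply, mul_apply_eq_comp, sub_smul]
  linear_combination (norm := module) h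

theorem res_mul_comm (hz : z ∈ rho A) (hw : w ∈ rho A) :
    res z A * res w A = res w A * res z A := by
  rcases eq_or_ne z w with rfl | h
  · rfl
  have h1 := res_sub_res hz hw
  have h2 := res_sub_res hw hz
  have h3 : (w - z) • (res z A * res w A) = (w - z) • (res w A * res z A) := by
    rw [← h1, ← neg_sub, h2, ← neg_smul, neg_sub]
  exact smul_right_injective _ (sub_ne_zero.2 h.symm) h3

/-- Difference of the resolvents of two operators that differ by a bounded operator. -/
theorem res_sub_res_of_perturbation {V : X →L[ℂ] X} (hdom : A.domain ≤ B.domain)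
    (hV : ∀ x (hx : x ∈ A.domain), B ⟨x, hdom hx⟩ = A ⟨x, hx⟩ + V x)
    (hzA : z ∈ rho A) (hzB : z ∈ rho B) :
    res z B - res z A = res z B * V * res z A := by
  ext x
  have h := res_apply_sub hzB ⟨res z A x, hdom (res_mem_domain hzA x)⟩
  rw [hV _ (res_mem_domain hzA x), apply_res hzA] at h
  simp only [map_sub, map_smul, map_add] at h
  simp only [sub_apply, mul_apply_eq_comp]
  linear_combination (norm := module) h

theorem applyAt_of_mem {y : X} (hy : y ∈ A.domain) : applyAt A y = A ⟨y, hy⟩ := by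
  rw [applyAt, dif_pos hy]

theorem applyAt_res (hz : z ∈ rho A) (x : X) : applyAt A (res z A x) = z • res z A x - x := by
  rw [applyAt_of_mem (res_mem_domain hz x), apply_res hz x]

theorem applyAt_res_of_mem_domain (hz : z ∈ rho A) {x : X} (hx : x ∈ A.domain) :
    applyAt A (res z A x) = res z A (A ⟨x, hx⟩) := by
  have h := res_apply_sub hz ⟨x, hx⟩
  rw [map_sub, map_smul] at h
  rw [applyAt_res hz]
  linear_combination (norm := module) h

theorem isNonpositive_norm_res_le (hA : IsNonpositive A) :
    ∃ M : ℝ, 0 < M ∧ ∀ t : ℝ, 0 < t → ‖res (t : ℂ) A‖ ≤ M / t := by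
  obtain ⟨M, hM⟩ := hA.bounded
  refine ⟨max M 1, by positivity, fun t ht => ?_⟩
  rw [le_div_iff₀ ht]
  have := hM t ht
  rw [norm_smul, Complex.norm_real, Real.norm_of_nonneg ht.le, mul_comm] at this
  exact this.trans (le_max_left _ _)

variable [CompleteSpace X]

/-- On D(A) one has w - A = (1 + (w - z) R(z, A)) (z - A), and the first factor is invertible for w
near z because the units form an open set. -/
theorem eventually_res_eq (hz : z ∈ rho A) :
    ∀ᶠ w in nhds z, w ∈ rho A ∧ res w A = res z A * Ring.inverse (1 + (w - z) • res z A) := by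
  have hu : ∀ᶠ w in nhds z, IsUnit (1 + (w - z) • res z A) := by
    have hc : ContinuousAt (fun w : ℂ => 1 + (w - z) • res z A) z := by fun_prop
    exact hc.eventually (Units.isOpen.mem_nhds (by simp))
  filter_upwards [hu] with w hw
  set R := res z A with hR
  set S := Ring.inverse (1 + (w - z) • R) with hS
  have h1 : (1 + (w - z) • R) * S = 1 := Ring.mul_inverse_cancel _ hw
  have hcomm : R * S = S * R := by
    have : Commute R (1 + (w - z) • R) :=
      (Commute.one_right R).add_right ((Commute.refl R).smul_right _)
    calc R * S = S * (1 + (w - z) • R) * (R * S) := by rw [Ring.inverse_mul_cancel _ hw, one_mul]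
      _ = S * ((1 + (w - z) • R) * R) * S := by simp only [mul_assoc]
      _ = S * (R * (1 + (w - z) • R)) * S := by rw [this.eq]
      _ = S * R * ((1 + (w - z) • R) * S) := by simp only [mul_assoc]
      _ = S * R := by rw [h1, mul_one]
  have hres : IsResolventAt A w (R * S) := by
    refine ⟨fun x => ⟨res_mem_domain hz _, ?_⟩, fun x => ?_⟩
    · have h2 := apply_res hz (S x)
      have h3 := congrArg (fun T : X →L[ℂ] X => T x) h1
      simp only [mul_apply_eq_comp, add_apply, smul_apply,
        one_apply_eq_self] at h3
      simp only [mul_apply_eq_comp]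
      rw [h2]
      linear_combination (norm := module) h3
    · have h2 := res_apply_sub hz x
      have h3 := congrArg (fun T : X →L[ℂ] X => T x) (Ring.inverse_mul_cancel _ hw)
      rw [hcomm]
      have h4 : R (w • (x : X) - A x) = x + (w - z) • R x := by
        rw [map_sub, map_smul] at h2 ⊢
        linear_combination (norm := module) h2
      rw [mul_apply_eq_comp, h4]
      simpa using h3
  exact ⟨⟨_, hres⟩, hres.eq_res.symm⟩

theorem isOpen_rho : IsOpen (rho A) :=
  isOpen_iff_eventually.2 fun _ hz => (eventually_res_eq hz).mono fun _ h => h.1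

theorem differentiableOn_res : DifferentiableOn ℂ (fun z => res z A) (rho A) := by
  intro z hz
  refine DifferentiableAt.differentiableWithinAt ?_
  have h1 : DifferentiableAt ℂ (fun w : ℂ => res z A * Ring.inverse (1 + (w - z) • res z A)) z := by
    refine (differentiableAt_const _).mul ?_
    refine DifferentiableAt.comp (g := Ring.inverse) z (differentiableAt_inverse (by simp)) ?_
    fun_prop
  exact h1.congr_of_eventuallyEq ((eventually_res_eq hz).mono fun _ h => h.2)

theorem continuousOn_res : ContinuousOn (fun z => res z A) (rho A) :=
  differentiableOn_res.continuousOn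

theorem hasDerivAt_res (hz : z ∈ rho A) :
    HasDerivAt (fun w => res w A) (-(res z A * res z A)) z := by
  have hc : ContinuousAt (fun w => res w A) z := continuousOn_res.continuousAt (isOpen_rho.mem_nhds hz)
  rw [hasDerivAt_iff_tendsto_slope]
  have h1 : Filter.Tendsto (fun w => -(res w A * res z A)) (nhdsWithin z {z}ᶜ)
      (nhds (-(res z A * res z A))) :=
    ((hc.mul continuousAt_const).neg.tendsto).mono_left nhdsWithin_le_nhds
  refine h1.congr' ?_
  filter_upwards [self_mem_nhdsWithin, mem_nhdsWithin_of_mem_nhds (isOpen_rho.mem_nhds hz)]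
    with w hw hwr
  have hne : w - z ≠ 0 := sub_ne_zero.2 hw
  rw [slope_def_module, res_sub_res hwr hz, smul_smul, ← neg_sub w z, mul_neg, inv_mul_cancel₀ hne,
    neg_one_smul]

/-- For large t the operator 1 - V R(t, A) is onto, and R(t, B)(1 - V R(t, A)) = R(t, A), so R(t, B)
maps into D(A). The equality of domains allows A and B to exchange roles. -/
theorem domain_eq_of_perturbation {V : X →L[ℂ] X} (hA : IsNonpositive A) (hB : IsNonpositive B)
    (hdom : A.domain ≤ B.domain)
    (hV : ∀ x (hx : x ∈ A.domain), B ⟨x, hdom hx⟩ = A ⟨x, hx⟩ + V x) :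
    A.domain = B.domain := by
  refine le_antisymm hdom fun y hy => ?_
  obtain ⟨M, hM0, hM⟩ := isNonpositive_norm_res_le hA
  -- Chosen so that ‖V‖ M / t = ‖V‖ / (‖V‖ + 1) < 1.
  set t : ℝ := M * (‖V‖ + 1) with ht
  have ht0 : 0 < t := by positivity
  have hsmall : ‖V * res (t : ℂ) A‖ < 1 := by
    refine (norm_mul_le _ _).trans_lt ?_
    have h1 := hM t ht0
    calc ‖V‖ * ‖res (t : ℂ) A‖ ≤ ‖V‖ * (M / t) := by gcongr
      _ = ‖V‖ / (‖V‖ + 1) := by rw [ht]; field_simp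
      _ < 1 := by rw [div_lt_one (by positivity)]; linarith
  have hu : IsUnit (1 - V * res (t : ℂ) A) := isUnit_one_sub_of_norm_lt_one hsmall
  have htA := hA.pos_mem_rho t ht0
  have htB := hB.pos_mem_rho t ht0
  set x := (t : ℂ) • y - B ⟨y, hy⟩ with hx
  set u := Ring.inverse (1 - V * res (t : ℂ) A) x with hudef
  have h1 : u - V (res (t : ℂ) A u) = x := by
    have := congrArg (fun T : X →L[ℂ] X => T x) (Ring.mul_inverse_cancel _ hu)
    simpa using this
  have h2 : res (t : ℂ) B (u - V (res (t : ℂ) A u)) = res (t : ℂ) A u := by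
    have := congrArg (fun T : X →L[ℂ] X => T u) (res_sub_res_of_perturbation hdom hV htA htB)
    simp only [sub_apply, mul_apply_eq_comp] at this
    rw [map_sub, ← this, sub_sub_cancel]
  have h3 : res (t : ℂ) B x = y := res_apply_sub htB ⟨y, hy⟩
  rw [← h3, ← h1, h2]
  exact res_mem_domain htA u

end Resolvent

/-! ### Riesz projections and the Laurent expansion of the resolvent -/

section Riesz

/-- Roots of the minimal polynomial are eigenvalues; over ℂ it splits, so it is a power of X. -/
theorem isNilpotent_of_forall_eigenvalue_eq_zero {V : Type*} [AddCommGroup V] [Module ℂ V]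
    [FiniteDimensional ℂ V] (f : Module.End ℂ V)
    (h : ∀ (μ : ℂ) (v : V), v ≠ 0 → f v = μ • v → μ = 0) : IsNilpotent f := by
  have hint : IsIntegral ℂ f := Algebra.IsIntegral.isIntegral f
  have hmonic := minpoly.monic hint
  have hroots : ∀ a ∈ (minpoly ℂ f).roots, a = 0 := fun a ha => by
    have hev : f.HasEigenvalue a :=
      Module.End.hasEigenvalue_of_isRoot (Polynomial.isRoot_of_mem_roots ha)
    obtain ⟨v, hv⟩ := hev.exists_hasEigenvector
    exact h a v hv.2 hv.apply_eq_smul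
  have hsplit := (IsAlgClosed.splits (minpoly ℂ f)).eq_prod_roots_of_monic hmonic
  rw [Multiset.eq_replicate_card.2 hroots] at hsplit
  refine ⟨(minpoly ℂ f).roots.card, ?_⟩
  have h0 := minpoly.aeval ℂ f
  rw [hsplit] at h0
  simpa using h0

theorem circleIntegral_clm_comp {E F : Type*} [NormedAddCommGroup E] [NormedSpace ℂ E]
    [CompleteSpace E] [NormedAddCommGroup F] [NormedSpace ℂ F] [CompleteSpace F] (L : E →L[ℂ] F)
    {f : ℂ → E} {c : ℂ} {r : ℝ} (hf : CircleIntegrable f c r) :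
    (∮ z in C(c, r), L (f z)) = L (∮ z in C(c, r), f z) := by
  simp only [circleIntegral, ← map_smul]
  exact L.intervalIntegral_comp_comm hf.out

variable {X : Type*} [NormedAddCommGroup X] [NormedSpace ℂ X]
  {A : X →ₗ.[ℂ] X} {z₀ : ℂ} {r s : ℝ}

/-- The moments `(2πi)⁻¹ ∮ (z - z₀) ^ m R(z, A) dz` of the resolvent. -/
def rieszMoment (A : X →ₗ.[ℂ] X) (z₀ : ℂ) (r : ℝ) (m : ℕ) : X →L[ℂ] X :=
  (2 * Real.pi * Complex.I : ℂ)⁻¹ • ∮ z in C(z₀, r), (z - z₀) ^ m • res z A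

theorem rieszMoment_zero : rieszMoment A z₀ r 0 = rieszProj A z₀ r := by
  simp [rieszMoment, rieszProj]

variable [CompleteSpace X]

theorem sphere_subset_punctured (hsr : s ≤ r) (hs : 0 < s) :
    Metric.sphere z₀ s ⊆ Metric.closedBall z₀ r \ {z₀} := fun z hz => by
  have hz' : dist z z₀ = s := hz
  refine ⟨?_, ?_⟩
  · rw [Metric.mem_closedBall, hz']; exact hsr
  · rintro rfl
    rw [dist_self] at hz'
    exact hs.ne hz'

theorem continuousOn_pow_smul_res (m : ℕ) :
    ContinuousOn (fun z => (z - z₀) ^ m • res z A) (rho A) :=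
  (by fun_prop : ContinuousOn (fun z : ℂ => (z - z₀) ^ m) (rho A)).smul continuousOn_res

theorem circleIntegrable_pow_smul_res (hsub : Metric.closedBall z₀ r \ {z₀} ⊆ rho A)
    (hs : 0 < s) (hsr : s ≤ r) (m : ℕ) :
    CircleIntegrable (fun z => (z - z₀) ^ m • res z A) z₀ s :=
  ((continuousOn_pow_smul_res m).mono
    ((sphere_subset_punctured hsr hs).trans hsub)).circleIntegrable hs.le

theorem rieszMoment_eq_of_le (hsub : Metric.closedBall z₀ r \ {z₀} ⊆ rho A)
    (hs : 0 < s) (hsr : s ≤ r) (m : ℕ) : rieszMoment A z₀ r m = rieszMoment A z₀ s m := by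
  rw [rieszMoment, rieszMoment]
  congr 1
  have hsub' : Metric.closedBall z₀ r \ Metric.ball z₀ s ⊆ rho A := fun z hz =>
    hsub ⟨hz.1, fun h => hz.2 (by rw [h]; exact Metric.mem_ball_self hs)⟩
  refine Complex.circleIntegral_eq_of_differentiable_on_annulus_off_countable hs hsr
    countable_empty ((continuousOn_pow_smul_res m).mono hsub') fun z hz => ?_
  have hz' : z ∈ rho A := hsub' ⟨Metric.ball_subset_closedBall hz.1.1,
    fun h => hz.1.2 (Metric.ball_subset_closedBall h)⟩
  exact (by fun_prop : DifferentiableAt ℂ (fun z : ℂ => (z - z₀) ^ m) z).smul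
    (hasDerivAt_res hz').differentiableAt

theorem mul_rieszMoment (hsub : Metric.closedBall z₀ r \ {z₀} ⊆ rho A)
    (hs : 0 < s) (hsr : s ≤ r) (m : ℕ) (T : X →L[ℂ] X) :
    T * rieszMoment A z₀ s m =
      (2 * Real.pi * Complex.I : ℂ)⁻¹ • ∮ z in C(z₀, s), (z - z₀) ^ m • (T * res z A) := by
  rw [rieszMoment, mul_smul_comm]
  congr 1
  have := circleIntegral_clm_comp (ContinuousLinearMap.mul ℂ (X →L[ℂ] X) T)
    (circleIntegrable_pow_smul_res hsub hs hsr m)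
  simp only [ContinuousLinearMap.mul_apply', mul_smul_comm] at this
  exact this.symm

theorem rieszMoment_mul (hsub : Metric.closedBall z₀ r \ {z₀} ⊆ rho A)
    (hs : 0 < s) (hsr : s ≤ r) (m : ℕ) (T : X →L[ℂ] X) :
    rieszMoment A z₀ s m * T =
      (2 * Real.pi * Complex.I : ℂ)⁻¹ • ∮ z in C(z₀, s), (z - z₀) ^ m • (res z A * T) := by
  rw [rieszMoment, smul_mul_assoc]
  congr 1
  have := circleIntegral_clm_comp ((ContinuousLinearMap.mul ℂ (X →L[ℂ] X)).flip T)
    (circleIntegrable_pow_smul_res hsub hs hsr m)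
  simp only [ContinuousLinearMap.flip_apply, ContinuousLinearMap.mul_apply', smul_mul_assoc] at this
  exact this.symm

theorem rieszMoment_comm_res (hr : 0 < r) (hsub : Metric.closedBall z₀ r \ {z₀} ⊆ rho A)
    {w : ℂ} (hw : w ∈ rho A) (m : ℕ) :
    rieszMoment A z₀ r m * res w A = res w A * rieszMoment A z₀ r m := by
  rw [mul_rieszMoment hsub hr le_rfl, rieszMoment_mul hsub hr le_rfl]
  congr 1
  refine circleIntegral.integral_congr hr.le fun z hz => ?_
  simp only [res_mul_comm (hsub (sphere_subset_punctured le_rfl hr hz)) hw]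

/-- The regular part of the resolvent. -/
def regularPart (A : X →ₗ.[ℂ] X) (z₀ : ℂ) (r : ℝ) (w : ℂ) : X →L[ℂ] X :=
  (2 * Real.pi * Complex.I : ℂ)⁻¹ • ∮ z in C(z₀, r), (z - w)⁻¹ • res z A

theorem circleIntegrable_res (hr : 0 < r) (hsub : Metric.closedBall z₀ r \ {z₀} ⊆ rho A) :
    CircleIntegrable (fun z => res z A) z₀ r := by
  simpa using circleIntegrable_pow_smul_res hsub hr le_rfl 0

theorem analyticOnNhd_regularPart (hr : 0 < r) (hsub : Metric.closedBall z₀ r \ {z₀} ⊆ rho A) :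
    AnalyticOnNhd ℂ (regularPart A z₀ r) (Metric.ball z₀ r) := by
  lift r to NNReal using hr.le
  have := (hasFPowerSeriesOn_cauchy_integral (circleIntegrable_res hr hsub)
    (by exact_mod_cast hr)).analyticOnNhd
  rw [Metric.eball_coe] at this
  exact this

theorem circleIntegral_pow_smul_regularPart (hr : 0 < r)
    (hsub : Metric.closedBall z₀ r \ {z₀} ⊆ rho A) (hs : 0 < s) (hsr : s < r) (m : ℕ) :
    (∮ z in C(z₀, s), (z - z₀) ^ m • regularPart A z₀ r z) = 0 := by
  have hd : DifferentiableOn ℂ (fun z => (z - z₀) ^ m • regularPart A z₀ r z)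
      (Metric.ball z₀ r) :=
    (by fun_prop : DifferentiableOn ℂ (fun z : ℂ => (z - z₀) ^ m) _).smul
      (analyticOnNhd_regularPart hr hsub).differentiableOn
  refine Complex.circleIntegral_eq_zero_of_differentiable_on_off_countable hs.le countable_empty
    (hd.continuousOn.mono (Metric.closedBall_subset_ball hsr)) fun z hz => ?_
  exact hd.differentiableAt (Metric.isOpen_ball.mem_nhds (Metric.ball_subset_ball hsr.le hz.1))

theorem two_pi_I_inv_smul_smul {E : Type*} [AddCommGroup E] [Module ℂ E] (x : E) :
    (2 * Real.pi * Complex.I : ℂ)⁻¹ • (2 * Real.pi * Complex.I : ℂ) • x = x :=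
  inv_smul_smul₀ Complex.two_pi_I_ne_zero x

/-- By the resolvent identity R(z)R(w) = (z - w)⁻¹ (R(w) - R(z)). Integrated over the circle, the
first term gives R(w) by Cauchy's formula and the second gives the regular part. -/
theorem rieszProj_mul_res (hr : 0 < r) (hsub : Metric.closedBall z₀ r \ {z₀} ⊆ rho A) {w : ℂ}
    (hw : w ∈ Metric.ball z₀ r) (hw0 : w ≠ z₀) :
    rieszProj A z₀ r * res w A = res w A - regularPart A z₀ r w := by
  have hwr : w ∈ rho A := hsub ⟨Metric.ball_subset_closedBall hw, hw0⟩
  have hne : ∀ z ∈ Metric.sphere z₀ r, z - w ≠ 0 := fun z hz h => by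
    rw [sub_eq_zero.1 h] at hz
    exact (Metric.mem_ball.1 hw).ne hz
  have hcinv : ContinuousOn (fun z : ℂ => (z - w)⁻¹) (Metric.sphere z₀ r) :=
    ContinuousOn.inv₀ (by fun_prop) hne
  have hcres : ContinuousOn (fun z => res z A) (Metric.sphere z₀ r) :=
    continuousOn_res.mono ((sphere_subset_punctured le_rfl hr).trans hsub)
  rw [← rieszMoment_zero, rieszMoment_mul hsub hr le_rfl, regularPart]
  have h1 : (∮ z in C(z₀, r), (z - z₀) ^ 0 • (res z A * res w A)) =
      ∮ z in C(z₀, r), ((z - w)⁻¹ • res w A - (z - w)⁻¹ • res z A) := by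
    refine circleIntegral.integral_congr hr.le fun z hz => ?_
    have hzr := hsub (sphere_subset_punctured le_rfl hr hz)
    simp only [pow_zero, one_smul]
    rw [← smul_sub, res_sub_res hwr hzr, inv_smul_smul₀ (hne z hz), res_mul_comm hwr hzr]
  have i1 : CircleIntegrable (fun z => (z - w)⁻¹ • res w A) z₀ r :=
    (hcinv.smul continuousOn_const).circleIntegrable hr.le
  have i2 : CircleIntegrable (fun z => (z - w)⁻¹ • res z A) z₀ r :=
    (hcinv.smul hcres).circleIntegrable hr.le
  rw [h1, circleIntegral.integral_sub i1 i2, circleIntegral.integral_smul_const,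
    circleIntegral.integral_sub_inv_of_mem_ball hw, smul_sub, two_pi_I_inv_smul_smul]

/-- Split z - z₀ = (z - w) + (w - z₀). Since (z - w) R(z)R(w) = R(w) - R(z) and the constant R(w)
integrates to 0, the first summand contributes -P. -/
theorem rieszMoment_one_mul_res (hr : 0 < r) (hsub : Metric.closedBall z₀ r \ {z₀} ⊆ rho A)
    {w : ℂ} (hw : w ∈ rho A) :
    rieszMoment A z₀ r 1 * res w A =
      (w - z₀) • (rieszProj A z₀ r * res w A) - rieszProj A z₀ r := by
  have hcres : ContinuousOn (fun z => res z A) (Metric.sphere z₀ r) :=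
    continuousOn_res.mono ((sphere_subset_punctured le_rfl hr).trans hsub)
  have hcmul : ContinuousOn (fun z => res z A * res w A) (Metric.sphere z₀ r) :=
    hcres.mul continuousOn_const
  have hconst : (∮ _ in C(z₀, r), res w A) = 0 :=
    Complex.circleIntegral_eq_zero_of_differentiable_on_off_countable hr.le countable_empty
      continuousOn_const fun z _ => differentiableAt_const _
  have hP : rieszProj A z₀ r * res w A =
      (2 * Real.pi * Complex.I : ℂ)⁻¹ • ∮ z in C(z₀, r), res z A * res w A := by
    rw [← rieszMoment_zero, rieszMoment_mul hsub hr le_rfl]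
    simp only [pow_zero, one_smul]
  rw [rieszMoment_mul hsub hr le_rfl, hP]
  have h1 : (∮ z in C(z₀, r), (z - z₀) ^ 1 • (res z A * res w A)) =
      ∮ z in C(z₀, r), ((res w A - res z A) + (w - z₀) • (res z A * res w A)) := by
    refine circleIntegral.integral_congr hr.le fun z hz => ?_
    have hzr := hsub (sphere_subset_punctured le_rfl hr hz)
    simp only [pow_one]
    rw [res_sub_res hw hzr, res_mul_comm hw hzr, ← add_smul]
    ring_nf
  have i1 : CircleIntegrable (fun z => res w A - res z A) z₀ r :=
    (continuousOn_const.sub hcres).circleIntegrable hr.le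
  have i2 : CircleIntegrable (fun z => (w - z₀) • (res z A * res w A)) z₀ r :=
    (hcmul.const_smul (w - z₀)).circleIntegrable hr.le
  rw [h1, circleIntegral.integral_add i1 i2,
    circleIntegral.integral_sub (circleIntegrable_const _ _ _) (hcres.circleIntegrable hr.le),
    hconst, circleIntegral.integral_smul, zero_sub, smul_add, smul_neg, smul_comm, rieszProj]
  abel

/-- On a smaller circle P R(z) is R(z) minus the regular part, which is analytic inside and
integrates to 0. The case m = 0 says that P is idempotent. -/
theorem rieszProj_mul_rieszMoment (hr : 0 < r) (hsub : Metric.closedBall z₀ r \ {z₀} ⊆ rho A)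
    (m : ℕ) : rieszProj A z₀ r * rieszMoment A z₀ r m = rieszMoment A z₀ r m := by
  have hs : 0 < r / 2 := by positivity
  have hsr : r / 2 < r := by linarith
  rw [rieszMoment_eq_of_le hsub hs hsr.le, mul_rieszMoment hsub hs hsr.le, rieszMoment]
  congr 1
  have hreg : ContinuousOn (fun z => (z - z₀) ^ m • regularPart A z₀ r z)
      (Metric.sphere z₀ (r / 2)) :=
    (by fun_prop : ContinuousOn (fun z : ℂ => (z - z₀) ^ m) _).smul
      ((analyticOnNhd_regularPart hr hsub).continuousOn.mono
        (Metric.sphere_subset_closedBall.trans (Metric.closedBall_subset_ball hsr)))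
  have h1 : (∮ z in C(z₀, r / 2), (z - z₀) ^ m • (rieszProj A z₀ r * res z A)) =
      ∮ z in C(z₀, r / 2),
        ((z - z₀) ^ m • res z A - (z - z₀) ^ m • regularPart A z₀ r z) := by
    refine circleIntegral.integral_congr hs.le fun z hz => ?_
    have hz0 := (sphere_subset_punctured hsr.le hs hz).2
    have hzb : z ∈ Metric.ball z₀ r := by
      rw [Metric.mem_ball, Metric.mem_sphere.1 hz]; exact hsr
    simp only [rieszProj_mul_res hr hsub hzb hz0, smul_sub]
  rw [h1, circleIntegral.integral_sub (circleIntegrable_pow_smul_res hsub hs hsr.le m)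
    (hreg.circleIntegrable hs.le), circleIntegral_pow_smul_regularPart hr hsub hs hsr, sub_zero]

theorem rieszMoment_mul_rieszProj (hr : 0 < r) (hsub : Metric.closedBall z₀ r \ {z₀} ⊆ rho A)
    (m : ℕ) : rieszMoment A z₀ r m * rieszProj A z₀ r = rieszMoment A z₀ r m := by
  conv_rhs => rw [← rieszProj_mul_rieszMoment hr hsub m]
  rw [← rieszMoment_zero, mul_rieszMoment hsub hr le_rfl, rieszMoment_mul hsub hr le_rfl]
  congr 1
  refine circleIntegral.integral_congr hr.le fun z hz => ?_
  simp only [rieszMoment_comm_res hr hsub (hsub (sphere_subset_punctured le_rfl hr hz)) m]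

/-- `(A - z₀) P` has no eigenvalue other than `0`. -/
theorem rieszMoment_one_eigenvalue_eq_zero (hr : 0 < r)
    (hsub : Metric.closedBall z₀ r \ {z₀} ⊆ rho A) {μ : ℂ} {v : X} (hv : v ≠ 0)
    (h : rieszMoment A z₀ r 1 v = μ • v) : μ = 0 := by
  by_contra hμ
  have hPv : rieszProj A z₀ r v = v := by
    have h1 := congrArg (fun T : X →L[ℂ] X => T v) (rieszProj_mul_rieszMoment hr hsub 1)
    simp only [mul_apply_eq_comp, h, map_smul] at h1
    exact smul_right_injective _ hμ h1
  -- The circle is shrunk so that z₀ + μ lies outside. On it R(z, A) v = (z - z₀ - μ)⁻¹ v, which is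
  -- analytic inside, so P v = 0, against P v = v.
  set s : ℝ := min r (‖μ‖ / 2) with hs
  have hs0 : 0 < s := lt_min hr (by have := norm_pos_iff.2 hμ; positivity)
  have hsr : s ≤ r := min_le_left _ _
  have hsμ : s < ‖μ‖ := (min_le_right _ _).trans_lt (by have := norm_pos_iff.2 hμ; linarith)
  have hne : ∀ z ∈ Metric.closedBall z₀ s, z - z₀ - μ ≠ 0 := fun z hz h => by
    rw [Metric.mem_closedBall, dist_eq_norm, sub_eq_zero.1 h] at hz
    exact absurd hz (not_le.2 hsμ)
  have hres : ∀ z ∈ Metric.sphere z₀ s, res z A v = (z - z₀ - μ)⁻¹ • v := fun z hz => by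
    have hzr := hsub (sphere_subset_punctured hsr hs0 hz)
    have h1 := congrArg (fun T : X →L[ℂ] X => T v) (rieszMoment_one_mul_res hr hsub hzr)
    rw [rieszMoment_comm_res hr hsub hzr, ← rieszMoment_zero, rieszMoment_comm_res hr hsub hzr,
      rieszMoment_zero] at h1
    simp only [mul_apply_eq_comp, sub_apply, smul_apply, h, hPv, map_smul] at h1
    have h2 : (z - z₀ - μ) • res z A v = v := by
      linear_combination (norm := module) -h1
    rw [← h2, smul_smul, inv_mul_cancel₀ (hne z (Metric.sphere_subset_closedBall hz)), one_smul, h2]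
  have hzero : rieszProj A z₀ r v = 0 := by
    rw [← rieszMoment_zero, rieszMoment_eq_of_le hsub hs0 hsr, rieszMoment, smul_apply]
    have h1 := circleIntegral_clm_comp (ContinuousLinearMap.apply ℂ X v)
      (circleIntegrable_pow_smul_res hsub hs0 hsr 0)
    rw [ContinuousLinearMap.apply_apply] at h1
    rw [← h1]
    have h2 : (∮ z in C(z₀, s), (ContinuousLinearMap.apply ℂ X v) ((z - z₀) ^ 0 • res z A)) =
        ∮ z in C(z₀, s), (z - z₀ - μ)⁻¹ • v := by
      refine circleIntegral.integral_congr hs0.le fun z hz => ?_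
      simpa using hres z hz
    rw [h2, Complex.circleIntegral_eq_zero_of_differentiable_on_off_countable hs0.le
      countable_empty, smul_zero]
    · exact (ContinuousOn.inv₀ (by fun_prop) hne).smul continuousOn_const
    · intro z hz
      refine DifferentiableAt.smul_const (DifferentiableAt.inv (by fun_prop) ?_) v
      exact hne z (Metric.ball_subset_closedBall hz.1)
  exact hv (hPv.symm.trans hzero)

theorem isNilpotent_rieszMoment_one (hr : 0 < r) (hsub : Metric.closedBall z₀ r \ {z₀} ⊆ rho A)
    (hfin : FiniteDimensional ℂ (rieszProj A z₀ r).range) :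
    IsNilpotent (rieszMoment A z₀ r 1) := by
  set P := rieszProj A z₀ r with hP
  set D := rieszMoment A z₀ r 1 with hD
  have hmem : ∀ x, D x ∈ P.range := fun x => by
    have h1 := congrArg (fun T : X →L[ℂ] X => T x) (rieszProj_mul_rieszMoment hr hsub 1)
    exact ⟨D x, h1⟩
  let f : Module.End ℂ P.range := (D : X →ₗ[ℂ] X).restrict fun x _ => hmem x
  obtain ⟨n, hn⟩ := isNilpotent_of_forall_eigenvalue_eq_zero f fun μ v hv hμ =>
    rieszMoment_one_eigenvalue_eq_zero hr hsub (v := (v : X)) (by simpa using hv)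
      (congrArg Subtype.val hμ)
  have hpow : ∀ (m : ℕ) (v : P.range), (D ^ m) (v : X) = ((f ^ m) v : P.range) := fun m => by
    induction m with
    | zero => intro v; simp
    | succ m ih => intro v; rw [pow_succ, pow_succ]; exact ih (f v)
  -- The extra power brings an arbitrary vector into the range of P, where the n-th power vanishes.
  refine ⟨n + 1, ?_⟩
  ext x
  rw [pow_succ, mul_apply_eq_comp]
  have := hpow n ⟨D x, hmem x⟩
  rw [hn] at this
  simpa using this

/-- Laurent expansion of the resolvent at an isolated eigenvalue of finite multiplicity. -/
theorem IsIsolatedEigenvalue.exists_laurent {k : ℕ} (h : IsIsolatedEigenvalue A z₀ k) :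
    ∃ (P D : X →L[ℂ] X) (n : ℕ) (H : ℂ → X →L[ℂ] X),
      P * P = P ∧ FiniteDimensional ℂ P.range ∧ Module.finrank ℂ P.range = k ∧
      IsNilpotent D ∧ D * P = D ∧ P * D = D ∧ AnalyticAt ℂ H z₀ ∧
      ∀ᶠ w in nhdsWithin z₀ {z₀}ᶜ, w ∈ rho A ∧
        res w A = ∑ j ∈ Finset.range (n + 1), ((w - z₀) ^ (j + 1))⁻¹ • (D ^ j * P) + H w := by
  obtain ⟨-, r, hr, hsub, hfin, hk⟩ := h
  obtain ⟨n, hn⟩ := isNilpotent_rieszMoment_one hr hsub hfin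
  refine ⟨rieszProj A z₀ r, rieszMoment A z₀ r 1, n, regularPart A z₀ r, ?_, hfin, hk, ⟨n, hn⟩,
    rieszMoment_mul_rieszProj hr hsub 1, rieszProj_mul_rieszMoment hr hsub 1,
    analyticOnNhd_regularPart hr hsub z₀ (Metric.mem_ball_self hr), ?_⟩
  · simpa only [rieszMoment_zero] using rieszProj_mul_rieszMoment hr hsub 0
  filter_upwards [self_mem_nhdsWithin, mem_nhdsWithin_of_mem_nhds (Metric.ball_mem_nhds z₀ hr)]
    with w hw0 hw
  have hwr : w ∈ rho A := hsub ⟨Metric.ball_subset_closedBall hw, hw0⟩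
  refine ⟨hwr, ?_⟩
  rw [← sub_eq_iff_eq_add, ← rieszProj_mul_res hr hsub hw hw0]
  set P := rieszProj A z₀ r
  set D := rieszMoment A z₀ r 1
  have hu : w - z₀ ≠ 0 := sub_ne_zero.2 hw0
  have hstep : P * res w A = (w - z₀)⁻¹ • (P + D * (P * res w A)) := by
    rw [← mul_assoc, rieszMoment_mul_rieszProj hr hsub 1, rieszMoment_one_mul_res hr hsub hwr,
      add_sub_cancel, inv_smul_smul₀ hu]
  -- Iterating `hstep` produces the principal part, with a remainder containing Dᵐ. It is used with
  -- m = n + 1, although Dⁿ = 0 already, so that the term j = 0 is always present.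
  have hiter : ∀ m : ℕ, P * res w A = ∑ j ∈ Finset.range m, ((w - z₀) ^ (j + 1))⁻¹ • (D ^ j * P) +
      ((w - z₀) ^ m)⁻¹ • (D ^ m * (P * res w A)) := fun m => by
    induction m with
    | zero => simp
    | succ m ih =>
      rw [Finset.sum_range_succ]
      conv_lhs => rw [ih]
      rw [add_assoc]
      congr 1
      conv_lhs => rw [hstep]
      rw [mul_smul_comm, smul_smul, ← mul_inv, ← pow_succ, mul_add, smul_add, ← mul_assoc, ← pow_succ]
  rw [hiter (n + 1), pow_succ D n, hn, zero_mul, zero_mul, smul_zero, add_zero]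

end Riesz

/-! ### The operators ψ_l(A) and the integral formula for Δ -/

section Psi

theorem integrableOn_Ioi_of_norm_le_div_sq {E : Type*} [NormedAddCommGroup E] {g : ℝ → E} {C l : ℝ}
    (hl : 0 < l) (hg : ContinuousOn g (Ioi 0)) (hC : ∀ t, 0 < t → ‖g t‖ ≤ C / t ^ 2) :
    IntegrableOn g (Ioi l) := by
  have h1 : IntegrableOn (fun t : ℝ => C * t ^ (-2 : ℝ)) (Ioi l) :=
    (integrableOn_Ioi_rpow_of_lt (by norm_num) hl).const_mul C
  refine Integrable.mono' h1
    ((hg.mono (Ioi_subset_Ioi hl.le)).aestronglyMeasurable measurableSet_Ioi) ?_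
  filter_upwards [ae_restrict_mem measurableSet_Ioi] with t ht
  have ht0 : 0 < t := hl.trans ht
  refine (hC t ht0).trans (le_of_eq ?_)
  rw [Real.rpow_neg ht0.le, div_eq_mul_inv]
  norm_num

theorem integral_psiMeasure {E : Type*} [NormedAddCommGroup E] [NormedSpace ℝ E] {l : ℝ}
    (hl : 0 < l) (f : ℝ → E) :
    ∫ t in Ioi (0 : ℝ), f t ∂(psiMeasure l) = ∫ t in Ioi l, t⁻¹ • f t := by
  rw [psiMeasure, restrict_withDensity measurableSet_Ioi, Measure.restrict_restrict measurableSet_Ioi,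
    Ioi_inter_Ioi, max_eq_right hl.le,
    integral_withDensity_eq_integral_toReal_smul (by fun_prop) (by simp)]
  refine setIntegral_congr_fun measurableSet_Ioi fun t ht => ?_
  have : 0 ≤ t⁻¹ := inv_nonneg.2 (hl.trans ht).le
  simp only [ENNReal.toReal_ofReal this]

variable {X : Type*} [NormedAddCommGroup X] [NormedSpace ℂ X] [CompleteSpace X]
  {A B : X →ₗ.[ℂ] X} {l : ℝ}

theorem IsNonpositive.continuousOn_res (hA : IsNonpositive A) :
    ContinuousOn (fun t : ℝ => res (t : ℂ) A) (Ioi 0) :=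
  PertDet.continuousOn_res.comp Complex.continuous_ofReal.continuousOn
    fun t ht => hA.pos_mem_rho t ht

theorem IsNonpositive.continuousOn_inv_smul_res (hA : IsNonpositive A) :
    ContinuousOn (fun t : ℝ => t⁻¹ • res (t : ℂ) A) (Ioi 0) :=
  (continuousOn_inv₀.mono fun _ ht => (ne_of_gt ht : _ ≠ (0 : ℝ))).smul hA.continuousOn_res

theorem IsNonpositive.integrableOn_inv_smul_res (hA : IsNonpositive A) (hl : 0 < l) :
    IntegrableOn (fun t : ℝ => t⁻¹ • res (t : ℂ) A) (Ioi l) := by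
  obtain ⟨M, -, hM⟩ := isNonpositive_norm_res_le hA
  refine integrableOn_Ioi_of_norm_le_div_sq (C := M) hl hA.continuousOn_inv_smul_res fun t ht => ?_
  rw [norm_smul, Real.norm_of_nonneg (inv_nonneg.2 ht.le)]
  calc t⁻¹ * ‖res (t : ℂ) A‖ ≤ t⁻¹ * (M / t) := by
        have := hM t ht
        gcongr
    _ = M / t ^ 2 := by field_simp

/-- The operator `∫_l^∞ R(t, A) dt / t`. -/
def resIntegral (l : ℝ) (A : X →ₗ.[ℂ] X) : X →L[ℂ] X :=
  ∫ t in Ioi l, t⁻¹ • res (t : ℂ) A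

/-- On D(A) the resolvent commutes with A, so the defining integral is a bounded operator applied to
A x. -/
theorem integral_applyAt_res (hA : IsNonpositive A) (hl : 0 < l) {x : X} (hx : x ∈ A.domain) :
    ∫ t in Ioi (0 : ℝ), applyAt A (res (t : ℂ) A x) ∂(psiMeasure l) =
      resIntegral l A (A ⟨x, hx⟩) := by
  rw [integral_psiMeasure hl, resIntegral,
    ContinuousLinearMap.integral_apply (hA.integrableOn_inv_smul_res hl)]
  refine setIntegral_congr_fun measurableSet_Ioi fun t ht => ?_
  simp only [smul_apply]
  rw [applyAt_res_of_mem_domain (hA.pos_mem_rho t (hl.trans ht)) hx]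

theorem res_mul_resIntegral (hA : IsNonpositive A) (hl : 0 < l) {z : ℂ} (hz : z ∈ rho A) :
    res z A * resIntegral l A = resIntegral l A * res z A := by
  have h := hA.integrableOn_inv_smul_res hl
  rw [resIntegral]
  have h1 := (ContinuousLinearMap.mul ℂ (X →L[ℂ] X) (res z A)).integral_comp_comm h
  have h2 := ((ContinuousLinearMap.mul ℂ (X →L[ℂ] X)).flip (res z A)).integral_comp_comm h
  simp only [ContinuousLinearMap.flip_apply, ContinuousLinearMap.mul_apply'] at h1 h2
  rw [← h1, ← h2]
  refine setIntegral_congr_fun measurableSet_Ioi fun t ht => ?_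
  simp only [mul_smul_comm, smul_mul_assoc, res_mul_comm hz (hA.pos_mem_rho t (hl.trans ht))]

/-- The graph whose closure defines `ψ_l(A)`. -/
def psiGraph (l : ℝ) (A : X →ₗ.[ℂ] X) : Submodule ℂ (X × X) :=
  (Submodule.span ℂ {p : X × X | p.1 ∈ A.domain ∧
    p.2 = ∫ t in Ioi (0 : ℝ), applyAt A (res (t : ℂ) A p.1) ∂(psiMeasure l)}).topologicalClosure

theorem mem_psiGraph (hA : IsNonpositive A) (hl : 0 < l) {x : X} (hx : x ∈ A.domain) :
    (x, resIntegral l A (A ⟨x, hx⟩)) ∈ psiGraph l A :=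
  Submodule.le_topologicalClosure _ (Submodule.subset_span
    ⟨hx, (integral_applyAt_res hA hl hx).symm⟩)

/-- A closed subspace contains the graph of `ψ_l(A)` if it does so over `D(A)`. -/
theorem psiGraph_le (hA : IsNonpositive A) (hl : 0 < l) {S : Submodule ℂ (X × X)}
    (hS : IsClosed (S : Set (X × X)))
    (h : ∀ x (hx : x ∈ A.domain), (x, resIntegral l A (A ⟨x, hx⟩)) ∈ S) : psiGraph l A ≤ S := by
  refine Submodule.topologicalClosure_minimal _ (Submodule.span_le.2 ?_) hS
  rintro ⟨x, y⟩ ⟨hx, hy⟩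
  rw [integral_applyAt_res hA hl hx] at hy
  simp only at hx hy
  rw [hy]
  exact h x hx

/-- On D(A) this follows from R(1, A) A x = R(1, A) x - x. Both sides are continuous in the pair, so
the relation survives the closure; as R(1, A) is injective, the closure is again a graph. -/
theorem res_one_of_mem_psiGraph (hA : IsNonpositive A) (hl : 0 < l) {p : X × X}
    (hp : p ∈ psiGraph l A) : res 1 A p.2 = resIntegral l A (res 1 A p.1 - p.1) := by
  let f : X × X →L[ℂ] X := (res 1 A).comp (ContinuousLinearMap.snd ℂ X X) -
    ((resIntegral l A) * (res 1 A - 1)).comp (ContinuousLinearMap.fst ℂ X X)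
  have h1 : (1 : ℂ) ∈ rho A := by simpa using hA.pos_mem_rho 1 one_pos
  have hle : psiGraph l A ≤ f.ker := psiGraph_le hA hl f.isClosed_ker fun x hx => by
    change res 1 A (resIntegral l A (A ⟨x, hx⟩)) - resIntegral l A (res 1 A x - x) = 0
    have h2 := congrArg (fun T : X →L[ℂ] X => T (A ⟨x, hx⟩)) (res_mul_resIntegral hA hl h1)
    simp only [mul_apply_eq_comp] at h2
    have h3 := res_apply_sub h1 ⟨x, hx⟩
    rw [one_smul, map_sub] at h3
    rw [h2, ← map_sub, sub_eq_zero.2, map_zero]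
    exact (sub_sub_cancel _ _).symm.trans (congrArg (res 1 A x - ·) h3)
  have := hle hp
  exact sub_eq_zero.1 this

theorem psiGraph_functional (hA : IsNonpositive A) (hl : 0 < l) (p : X × X)
    (hp : p ∈ psiGraph l A) (h0 : p.1 = 0) : p.2 = 0 := by
  have h1 : (1 : ℂ) ∈ rho A := by simpa using hA.pos_mem_rho 1 one_pos
  have := res_one_of_mem_psiGraph hA hl hp
  rw [h0, map_zero, sub_zero, map_zero] at this
  exact res_injective h1 (this.trans (map_zero _).symm)

theorem psi_graph (hA : IsNonpositive A) (hl : 0 < l) : (psi l A).graph = psiGraph l A :=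
  Submodule.toLinearPMap_graph_eq _ (psiGraph_functional hA hl)

theorem domain_le_psi_domain (hA : IsNonpositive A) (hl : 0 < l) :
    A.domain ≤ (psi l A).domain := fun x hx => by
  have h := mem_psiGraph hA hl hx
  rw [← psi_graph hA hl] at h
  exact LinearPMap.mem_domain_of_mem_graph h

variable {V : X →L[ℂ] X} {rep : ℕ → (X →L[ℂ] ℂ) × X}

/-- The nuclear operator valued function `R(z, B) V R(z, A)`. -/
def resDiff (hV : IsNuclearRep V rep) (B A : X →ₗ.[ℂ] X) (z : ℂ) : NuclearSpace X :=
  sandwich hV (res z B) (res z A)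

theorem differentiableOn_resDiff (hV : IsNuclearRep V rep) :
    DifferentiableOn ℂ (resDiff hV B A) (rho A ∩ rho B) :=
  ((sandwich hV).differentiable.comp_differentiableOn
    (differentiableOn_res.mono inter_subset_right)).clm_apply
      (differentiableOn_res.mono inter_subset_left)

theorem integrableOn_resDiff (hA : IsNonpositive A) (hB : IsNonpositive B)
    (hV : IsNuclearRep V rep) (hl : 0 < l) :
    IntegrableOn (fun t : ℝ => resDiff hV B A t) (Ioi l) := by
  obtain ⟨M, hM0, hM⟩ := isNonpositive_norm_res_le hA
  obtain ⟨M', hM'0, hM'⟩ := isNonpositive_norm_res_le hB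
  set S := ∑' n, ‖(rep n).1‖ * ‖(rep n).2‖ with hS
  have hS0 : 0 ≤ S := tsum_nonneg fun n => by positivity
  refine integrableOn_Ioi_of_norm_le_div_sq (C := S * M' * M) hl ?_ fun t ht => ?_
  · exact (differentiableOn_resDiff hV).continuousOn.comp Complex.continuous_ofReal.continuousOn
      fun t ht => ⟨hA.pos_mem_rho t ht, hB.pos_mem_rho t ht⟩
  · refine (norm_sandwich_le hV _ _).trans ?_
    calc S * ‖res (t : ℂ) B‖ * ‖res (t : ℂ) A‖
        ≤ S * (M' / t) * (M / t) := by
          have h1 := hM t ht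
          have h2 := hM' t ht
          gcongr
      _ = _ := by field_simp

/-- The nuclear extension of `ψ_l(B) - ψ_l(A)`. -/
def psiDiff (hV : IsNuclearRep V rep) (B A : X →ₗ.[ℂ] X) (l : ℝ) : NuclearSpace X :=
  ∫ t in Ioi l, resDiff hV B A t

/-- Since t⁻¹ A R(t, A) x = R(t, A) x - t⁻¹ x, the terms t⁻¹ x cancel in the difference and leave
R(t, B) x - R(t, A) x, which is integrable. -/
theorem resIntegral_sub_resIntegral (hA : IsNonpositive A) (hB : IsNonpositive B)
    (hdom : A.domain ≤ B.domain)
    (hAB : ∀ x (hx : x ∈ A.domain), B ⟨x, hdom hx⟩ = A ⟨x, hx⟩ + V x)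
    (hV : IsNuclearRep V rep) (hl : 0 < l) {x : X} (hx : x ∈ A.domain) :
    resIntegral l B (B ⟨x, hdom hx⟩) =
      resIntegral l A (A ⟨x, hx⟩) + (psiDiff hV B A l).toOp x := by
  have hiA := hA.integrableOn_inv_smul_res hl
  have hiB := hB.integrableOn_inv_smul_res hl
  have hiD := integrableOn_resDiff hA hB hV hl
  let L : NuclearSpace X →L[ℂ] X :=
    (ContinuousLinearMap.apply ℂ X x).comp NuclearSpace.toOp
  have hL : (psiDiff hV B A l).toOp x = ∫ t in Ioi l, L (resDiff hV B A t) :=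
    (L.integral_comp_comm hiD).symm
  have hA' : IntegrableOn (fun t : ℝ => (t⁻¹ • res (t : ℂ) A) (A ⟨x, hx⟩)) (Ioi l) :=
    (ContinuousLinearMap.apply ℂ X (A ⟨x, hx⟩)).integrable_comp hiA
  rw [hL, resIntegral, resIntegral, ContinuousLinearMap.integral_apply hiA,
    ContinuousLinearMap.integral_apply hiB, ← integral_add hA' (L.integrable_comp hiD)]
  refine setIntegral_congr_fun measurableSet_Ioi fun t ht => ?_
  have ht0 : 0 < t := hl.trans ht
  have htA := hA.pos_mem_rho t ht0
  have htB := hB.pos_mem_rho t ht0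
  have h1 : L (resDiff hV B A t) = (res (t : ℂ) B - res (t : ℂ) A) x := by
    change (sandwich hV (res (t : ℂ) B) (res (t : ℂ) A)).toOp x = _
    rw [toOp_sandwich, res_sub_res_of_perturbation hdom hAB htA htB]
  simp only [smul_apply]
  rw [h1, ← applyAt_res_of_mem_domain htA hx, ← applyAt_res_of_mem_domain htB (hdom hx),
    applyAt_res htA, applyAt_res htB, sub_apply]
  have h2 : ∀ y : X, t⁻¹ • ((t : ℂ) • y) = y := fun y => by
    rw [← Complex.coe_smul, smul_smul, Complex.ofReal_inv, inv_mul_cancel₀, one_smul]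
    exact_mod_cast ht0.ne'
  simp only [smul_sub, h2]
  abel

theorem isBoundedExtension_psiDiff (hA : IsNonpositive A) (hB : IsNonpositive B)
    (hdom : A.domain ≤ B.domain)
    (hAB : ∀ x (hx : x ∈ A.domain), B ⟨x, hdom hx⟩ = A ⟨x, hx⟩ + V x)
    (hV : IsNuclearRep V rep) (hl : 0 < l) :
    IsBoundedExtension (psi l B - psi l A) (psiDiff hV B A l).toOp := by
  set T := (psiDiff hV B A l).toOp with hT
  refine ⟨hA.dense_domain.mono fun x hx => ?_, fun x => ?_⟩
  · exact ⟨domain_le_psi_domain hB hl (hdom hx), domain_le_psi_domain hA hl hx⟩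
  -- The continuous map (x, y) ↦ (x, y + T x) sends the core of the graph of ψ_l(A) into the closed
  -- graph of ψ_l(B), hence also its closure. This settles the whole common domain, not merely D(A).
  · let shear : X × X →L[ℂ] X × X := (ContinuousLinearMap.fst ℂ X X).prod
      (ContinuousLinearMap.snd ℂ X X + T.comp (ContinuousLinearMap.fst ℂ X X))
    have hle : psiGraph l A ≤ (psiGraph l B).comap (shear : X × X →ₗ[ℂ] X × X) := by
      refine psiGraph_le hA hl ?_ fun y hy => ?_
      · exact (Submodule.isClosed_topologicalClosure _).preimage shear.continuous
      · change (y, resIntegral l A (A ⟨y, hy⟩) + T y) ∈ psiGraph l B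
        rw [← resIntegral_sub_resIntegral hA hB hdom hAB hV hl hy]
        exact mem_psiGraph hB hl (hdom hy)
    have hxA : ((x : X), psi l A ⟨x, x.2.2⟩) ∈ psiGraph l A := by
      rw [← psi_graph hA hl]
      exact (psi l A).mem_graph ⟨x, x.2.2⟩
    have hxB : ((x : X), psi l A ⟨x, x.2.2⟩ + T x) ∈ (psi l B).graph := by
      rw [psi_graph hB hl]
      exact hle hxA
    have hxB' : ((x : X), psi l B ⟨x, x.2.1⟩) ∈ (psi l B).graph := 
      (psi l B).mem_graph ⟨x, x.2.1⟩
    have h1 := LinearPMap.mem_graph_snd_inj (psi l B) hxB hxB' rfl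
    rw [LinearPMap.sub_apply]
    exact (eq_sub_of_add_eq' h1)

/-- By density the bounded extension is unique, so the chosen one is `psiDiff`; the trace,
continuous on the nuclear space, passes under the integral. -/
theorem pertDet_eq_exp_integral (hAP : HasApproximationProperty X) (hA : IsNonpositive A)
    (hB : IsNonpositive B) (hdom : A.domain ≤ B.domain)
    (hAB : ∀ x (hx : x ∈ A.domain), B ⟨x, hdom hx⟩ = A ⟨x, hx⟩ + V x)
    (hV : IsNuclearRep V rep) (hl : 0 < l) :
    pertDet B A l =
      Complex.exp (∫ t in Ioi l, NuclearSpace.trace hAP (resDiff hV B A (t : ℝ))) := by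
  have hext := isBoundedExtension_psiDiff hA hB hdom hAB hV hl
  have hnuc : IsNuclearPMap (psi l B - psi l A) := ⟨_, hext, isNuclear_toOp _⟩
  have huniq : hnuc.choose = (psiDiff hV B A l).toOp := by
    refine DFunLike.coe_injective (Continuous.ext_on hext.1 (ContinuousLinearMap.continuous _)
      (ContinuousLinearMap.continuous _) fun x hx => ?_)
    rw [hext.2 ⟨x, hx⟩]
    exact hnuc.choose_spec.1.2 ⟨x, hx⟩
  rw [pertDet, pmapTrace, dif_pos hnuc, huniq, nuclearTrace_toOp hAP, psiDiff,
    ← ContinuousLinearMap.integral_comp_comm _ (integrableOn_resDiff hA hB hV hl)]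

end Psi

/-! ### Determinants of finite rank perturbations -/

section FiniteDeterminants

/-- Jacobi's formula. -/
theorem hasDerivAt_det {n : Type*} [Fintype n] [DecidableEq n] {M : ℂ → Matrix n n ℂ}
    {M' : Matrix n n ℂ} {z : ℂ} (h : ∀ i j, HasDerivAt (fun w => M w i j) (M' i j) z) :
    HasDerivAt (fun w => (M w).det) ((M z).adjugate * M').trace z := by
  let d : ContinuousMultilinearMap ℂ (fun _ : n => n → ℂ) ℂ :=
    { toMultilinearMap := (Matrix.detRowAlternating (n := n) (R := ℂ)).toMultilinearMap
      cont := Continuous.matrix_det continuous_id }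
  have hM : HasDerivAt (fun w => (fun i j => M w i j : n → n → ℂ)) (fun i j => M' i j) z :=
    hasDerivAt_pi.2 fun i => hasDerivAt_pi.2 fun j => h i j
  have hd := (d.hasFDerivAt (fun i j => M z i j)).comp_hasDerivAt z hM
  refine hd.congr_deriv ?_
  rw [ContinuousMultilinearMap.linearDeriv_apply, Matrix.trace_mul_comm, Matrix.trace]
  refine Finset.sum_congr rfl fun i _ => ?_
  have h1 : d (Function.update (fun i j => M z i j) i (fun j => M' i j)) =
      ((M z).updateRow i (M' i)).det := rfl
  rw [h1, ← Matrix.cramer_transpose_apply, Matrix.cramer_eq_adjugate_mulVec, Matrix.diag_apply,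
    Matrix.mul_apply, Matrix.mulVec, dotProduct]
  refine Finset.sum_congr rfl fun j _ => ?_
  rw [← Matrix.adjugate_transpose, Matrix.transpose_apply, mul_comm]

theorem logDeriv_det {n : Type*} [Fintype n] [DecidableEq n] {M : ℂ → Matrix n n ℂ}
    {M' K : Matrix n n ℂ} {z : ℂ} (h : ∀ i j, HasDerivAt (fun w => M w i j) (M' i j) z)
    (hK : M z * K = 1) :
    (M z).det ≠ 0 ∧ logDeriv (fun w => (M w).det) z = (K * M').trace := by
  have hdet : (M z).det * K.det = 1 := by rw [← Matrix.det_mul, hK, Matrix.det_one]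
  have hne : (M z).det ≠ 0 := left_ne_zero_of_mul_eq_one hdet
  refine ⟨hne, ?_⟩
  have hadj : (M z).adjugate = (M z).det • K := by
    calc (M z).adjugate = (M z).adjugate * (M z * K) := by rw [hK, mul_one]
      _ = (M z).det • K := by rw [← mul_assoc, Matrix.adjugate_mul, smul_mul_assoc, one_mul]
  rw [logDeriv_apply, (hasDerivAt_det h).deriv, hadj, Matrix.smul_mul, Matrix.trace_smul,
    smul_eq_mul, mul_div_cancel_left₀ _ hne]

variable {X : Type*} [NormedAddCommGroup X] [NormedSpace ℂ X]

/-- The partial sums of a series of dyads. -/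
def partialOp (rep : ℕ → (X →L[ℂ] ℂ) × X) (n : ℕ) : X →L[ℂ] X :=
  ∑ i ∈ Finset.range n, (rep i).1.smulRight (rep i).2

/-- The matrix with the entries `fᵢ(R xⱼ)`. -/
def dyadMatrix (rep : ℕ → (X →L[ℂ] ℂ) × X) (n : ℕ) (R : X →L[ℂ] X) : Matrix (Fin n) (Fin n) ℂ :=
  Matrix.of fun i j : Fin n => (rep i).1 (R (rep j).2)

theorem partialOp_apply (rep : ℕ → (X →L[ℂ] ℂ) × X) (n : ℕ) (y : X) :
    partialOp rep n y = ∑ i : Fin n, (rep i).1 y • (rep i).2 := by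
  rw [Fin.sum_univ_eq_sum_range (fun i => (rep i).1 y • (rep i).2) n, partialOp, sum_apply]
  rfl

theorem hasDerivAt_one_add_dyadMatrix (rep : ℕ → (X →L[ℂ] ℂ) × X) (n : ℕ) {R : ℂ → X →L[ℂ] X}
    {R' : X →L[ℂ] X} {z : ℂ} (hR : HasDerivAt R R' z) (i j : Fin n) :
    HasDerivAt (fun w => (1 + dyadMatrix rep n (R w)) i j) (dyadMatrix rep n R' i j) z := by
  let L : (X →L[ℂ] X) →L[ℂ] ℂ := (rep i).1.comp (ContinuousLinearMap.apply ℂ X (rep j).2)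
  have h := (L.hasFDerivAt.comp_hasDerivAt z hR).const_add ((1 : Matrix (Fin n) (Fin n) ℂ) i j)
  exact h

/-- Logarithmic derivative of the determinant of `1 + Vₙ R(z)`, where `Vₙ` is the `n`-th partial
sum of a series of dyads and `R` satisfies the differential equation of a resolvent. -/
theorem logDeriv_det_one_add_dyadMatrix (rep : ℕ → (X →L[ℂ] ℂ) × X) (n : ℕ) {R : ℂ → X →L[ℂ] X}
    {z : ℂ} (hR : HasDerivAt R (-(R z * R z)) z) {C : X →L[ℂ] X}
    (hC : (1 + partialOp rep n * R z) * C = 1) :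
    (1 + dyadMatrix rep n (R z)).det ≠ 0 ∧
      logDeriv (fun w => (1 + dyadMatrix rep n (R w)).det) z =
        -∑ i ∈ Finset.range n, (rep i).1 (R z (R z (C (rep i).2))) := by
  have hCx : ∀ y, C y + ∑ k : Fin n, (rep k).1 (R z (C y)) • (rep k).2 = y := fun y => by
    have := congrArg (fun T : X →L[ℂ] X => T y) hC
    simp only [mul_apply_eq_comp, add_apply, one_apply_eq_self, partialOp_apply] at this
    exact this
  -- With M(T) the dyad matrix of T and Vₙ the partial sum, M(T) M(S) = M(T Vₙ S), while VₙRC = 1 -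
  -- C. Hence 1 - M(RC) inverts 1 + M(R), and the trace in Jacobi's formula collapses to -tr M(R²C).
  have hprod : ∀ T : X →L[ℂ] X, dyadMatrix rep n T * dyadMatrix rep n (R z * C) =
      dyadMatrix rep n T - dyadMatrix rep n (T * C) := fun T => by
    ext i j
    have h1 := congrArg (fun y => (rep i).1 (T y)) (hCx (rep j).2)
    simp only [map_add, map_sum, map_smul, smul_eq_mul] at h1
    simp only [dyadMatrix, Matrix.mul_apply, Matrix.of_apply, Matrix.sub_apply, mul_apply_eq_comp]
    rw [← h1, add_sub_cancel_left]
    exact Finset.sum_congr rfl fun k _ => mul_comm _ _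
  have hK : (1 + dyadMatrix rep n (R z)) * (1 - dyadMatrix rep n (R z * C)) = 1 := by
    rw [mul_sub, mul_one, add_mul, one_mul, hprod]
    abel
  have h := logDeriv_det (hasDerivAt_one_add_dyadMatrix rep n hR) hK
  refine ⟨h.1, ?_⟩
  rw [h.2, Matrix.trace_mul_comm, mul_sub, mul_one, hprod, sub_sub_cancel, Matrix.trace,
    ← Fin.sum_univ_eq_sum_range (fun i => (rep i).1 (R z (R z (C (rep i).2)))) n,
    ← Finset.sum_neg_distrib]
  refine Finset.sum_congr rfl fun i _ => ?_
  simp [dyadMatrix]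

end FiniteDeterminants

/-! ### Single valued limits from convergent logarithmic derivatives -/

section Continuation

/-- For p a primitive of f'/f on the disc, f e⁻ᵖ has zero derivative. -/
theorem exists_sub_eq_of_logDeriv {f : ℂ → ℂ} {z : ℂ} {δ : ℝ}
    (hf : DifferentiableOn ℂ f (Metric.ball z δ)) (h0 : ∀ w ∈ Metric.ball z δ, f w ≠ 0) :
    ∃ p : ℂ → ℂ, (∀ w ∈ Metric.ball z δ, HasDerivAt p (logDeriv f w) w) ∧
      ∀ u ∈ Metric.ball z δ, ∀ w ∈ Metric.ball z δ, f w / f u = Complex.exp (p w - p u) := by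
  have hopen : IsOpen (Metric.ball z δ) := Metric.isOpen_ball
  have hl : DifferentiableOn ℂ (logDeriv f) (Metric.ball z δ) :=
    (hf.deriv hopen).div hf h0
  obtain ⟨p, hp⟩ := hl.isExactOn_ball
  refine ⟨p, hp, fun u hu w hw => ?_⟩
  have hd : ∀ v ∈ Metric.ball z δ, HasDerivAt (fun v => f v * Complex.exp (-p v)) 0 v :=
    fun v hv => by
      have h1 := ((hf.differentiableAt (hopen.mem_nhds hv)).hasDerivAt).mul (hp v hv).neg.cexp
      refine h1.congr_deriv ?_
      rw [logDeriv_apply]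
      field_simp [h0 v hv]
      ring
  have hconst := (convex_ball z δ).is_const_of_fderivWithin_eq_zero (𝕜 := ℂ)
    (f := fun v => f v * Complex.exp (-p v))
    (fun v hv => (hd v hv).differentiableAt.differentiableWithinAt)
    (fun v hv => by
      rw [fderivWithin_of_isOpen hopen hv]
      ext
      simp [(hd v hv).deriv]) hu hw
  rw [Complex.exp_sub, div_eq_div_iff (h0 u hu) (Complex.exp_ne_zero _)]
  simp only [Complex.exp_neg] at hconst
  field_simp at hconst
  linear_combination -hconst

/-- F(z) is the limit of f n z / f n a. On small discs such ratios are exponentials of differences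
of primitives and converge; connectedness chains the discs together. As the limit of globally
defined ratios, F is single valued without simple connectivity. -/
theorem exists_continuation_of_logDeriv_tendsto {U : Set ℂ}
    (hconn : IsPreconnected U) {a : ℂ} (ha : a ∈ U) {f : ℕ → ℂ → ℂ} {g : ℂ → ℂ}
    (hg : DifferentiableOn ℂ g U) (hf : ∀ n, DifferentiableOn ℂ (f n) U)
    (hlim : ∀ z ∈ U, ∃ δ > 0, Metric.ball z δ ⊆ U ∧ ∀ ε > 0, ∀ᶠ n in Filter.atTop,
      ∀ w ∈ Metric.ball z δ, f n w ≠ 0 ∧ ‖logDeriv (f n) w - g w‖ ≤ ε) :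
    ∃ F : ℂ → ℂ, ∀ z ∈ U, F z ≠ 0 ∧ HasDerivAt F (g z * F z) z := by
  have hlocal : ∀ z ∈ U, ∃ δ > 0, ∃ p : ℂ → ℂ,
      (∀ w ∈ Metric.ball z δ, HasDerivAt p (g w) w) ∧
      ∀ u ∈ Metric.ball z δ, ∀ w ∈ Metric.ball z δ,
        Filter.Tendsto (fun n => f n w / f n u) Filter.atTop (nhds (Complex.exp (p w - p u))) := by
    intro z hz
    obtain ⟨δ, hδ, hsub, hε⟩ := hlim z hz
    obtain ⟨p, hp⟩ := (hg.mono hsub).isExactOn_ball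
    refine ⟨δ, hδ, p, hp, fun u hu w hw => ?_⟩
    have hN : ∀ᶠ n in Filter.atTop, ∀ w ∈ Metric.ball z δ, f n w ≠ 0 :=
      (hε 1 one_pos).mono fun n hn w hw => (hn w hw).1
    have hex : ∀ n, ∃ q : ℂ → ℂ, (∀ w ∈ Metric.ball z δ, f n w ≠ 0) →
        (∀ w ∈ Metric.ball z δ, HasDerivAt q (logDeriv (f n) w) w) ∧
        ∀ u ∈ Metric.ball z δ, ∀ w ∈ Metric.ball z δ, f n w / f n u = Complex.exp (q w - q u) := by
      intro n
      by_cases h : ∀ w ∈ Metric.ball z δ, f n w ≠ 0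
      · obtain ⟨q, hq⟩ := exists_sub_eq_of_logDeriv ((hf n).mono hsub) h
        exact ⟨q, fun _ => hq⟩
      · exact ⟨0, fun h' => absurd h' h⟩
    choose q hq using hex
    -- The mean value inequality applied to q n - p; the + 1 in the tolerance makes the final bound
    -- strict and covers w = u.
    have hq1 : Filter.Tendsto (fun n => q n w - q n u) Filter.atTop (nhds (p w - p u)) := by
      rw [Metric.tendsto_atTop']
      intro ε hε0
      have hη : 0 < ε / (‖w - u‖ + 1) := by positivity
      obtain ⟨N, hN'⟩ := Filter.eventually_atTop.1 ((hε _ hη).and hN)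
      refine ⟨N, fun n hn => ?_⟩
      obtain ⟨h1, h2⟩ := hN' n hn.le
      have h3 := (convex_ball z δ).norm_image_sub_le_of_norm_hasDerivWithin_le
        (f := fun v => q n v - p v) (f' := fun v => logDeriv (f n) v - g v)
        (C := ε / (‖w - u‖ + 1))
        (fun v hv => (((hq n h2).1 v hv).sub (hp v hv)).hasDerivWithinAt)
        (fun v hv => (h1 v hv).2) hu hw
      rw [dist_eq_norm]
      have h4 : q n w - q n u - (p w - p u) = q n w - p w - (q n u - p u) := by ring
      rw [h4]
      refine h3.trans_lt ?_
      rw [div_mul_eq_mul_div, div_lt_iff₀ (by positivity)]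
      nlinarith [norm_nonneg (w - u)]
    refine ((Complex.continuous_exp.tendsto _).comp hq1).congr' ?_
    filter_upwards [hN] with n hn
    exact ((hq n hn).2 u hu w hw).symm
  have hne : ∀ z ∈ U, ∀ᶠ n in Filter.atTop, f n z ≠ 0 := fun z hz => by
    obtain ⟨δ, hδ, -, hε⟩ := hlim z hz
    exact (hε 1 one_pos).mono fun n hn => (hn z (Metric.mem_ball_self hδ)).1
  have hchain : ∀ {x y w : ℂ} {L L' : ℂ}, y ∈ U →
      Filter.Tendsto (fun n => f n y / f n x) Filter.atTop (nhds L) →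
      Filter.Tendsto (fun n => f n w / f n y) Filter.atTop (nhds L') →
      Filter.Tendsto (fun n => f n w / f n x) Filter.atTop (nhds (L' * L)) := by
    intro x y w L L' hy h1 h2
    refine (h2.mul h1).congr' ?_
    filter_upwards [hne y hy] with n hn
    exact div_mul_div_cancel₀ hn
  have hall : ∀ z ∈ U, ∃ L : ℂ, L ≠ 0 ∧
      Filter.Tendsto (fun n => f n z / f n a) Filter.atTop (nhds L) := fun z hz => by
    refine hconn.induction₂' (fun x y => ∃ L : ℂ, L ≠ 0 ∧
      Filter.Tendsto (fun n => f n y / f n x) Filter.atTop (nhds L)) ?_ ?_ ha hz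
    · intro x hx
      obtain ⟨δ, hδ, p, -, hp⟩ := hlocal x hx
      have hx' := Metric.mem_ball_self (x := x) hδ
      filter_upwards [mem_nhdsWithin_of_mem_nhds (Metric.ball_mem_nhds x hδ)] with y hy
      exact ⟨⟨_, Complex.exp_ne_zero _, hp x hx' y hy⟩, ⟨_, Complex.exp_ne_zero _, hp y hy x hx'⟩⟩
    · rintro x y w - hy - ⟨L, hL, h1⟩ ⟨L', hL', h2⟩
      exact ⟨L' * L, mul_ne_zero hL' hL, hchain hy h1 h2⟩
  choose! F hF0 hF using hall
  refine ⟨F, fun z hz => ⟨hF0 z hz, ?_⟩⟩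
  obtain ⟨δ, hδ, p, hpd, hp⟩ := hlocal z hz
  have hz' := Metric.mem_ball_self (x := z) hδ
  obtain ⟨δ', hδ', hsub, -⟩ := hlim z hz
  have heq : F =ᶠ[nhds z] fun w => Complex.exp (p w - p z) * F z := by
    filter_upwards [Metric.ball_mem_nhds z hδ, Metric.ball_mem_nhds z hδ'] with w hw hw'
    exact tendsto_nhds_unique (hF w (hsub hw')) (hchain hz (hF z hz) (hp z hz' w hw))
  have hd : HasDerivAt (fun w => Complex.exp (p w - p z) * F z)
      (Complex.exp (p z - p z) * g z * F z) z :=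
    (((hpd z hz').sub_const _).cexp).mul_const _
  rw [sub_self, Complex.exp_zero, one_mul] at hd
  exact hd.congr_of_eventuallyEq heq

end Continuation

/-! ### Analytic continuation of the perturbation determinant -/

section Determinant

variable {X : Type*} [NormedAddCommGroup X] [NormedSpace ℂ X]

/-- Approximation of `∑ fᵢ(R² C xᵢ)` by partial sums with a perturbed `C`. -/
theorem norm_sum_range_sub_le {rep : ℕ → (X →L[ℂ] ℂ) × X}
    (hs : Summable fun n => ‖(rep n).1‖ * ‖(rep n).2‖) {R C C' : X →L[ℂ] X} {b c d : ℝ}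
    (hb : ‖R‖ ≤ b) (hc : ‖C‖ ≤ c) (hd : ‖C' - C‖ ≤ d) {s : ℂ}
    (hsum : HasSum (fun i => (rep i).1 (R (R (C (rep i).2)))) s) (n : ℕ) :
    ‖∑ i ∈ Finset.range n, (rep i).1 (R (R (C' (rep i).2))) - s‖ ≤
      b * b * d * (∑' i, ‖(rep i).1‖ * ‖(rep i).2‖) +
        b * b * c * ∑' i, ‖(rep (i + n)).1‖ * ‖(rep (i + n)).2‖ := by
  have hb0 : 0 ≤ b := (norm_nonneg _).trans hb
  have hc0 : 0 ≤ c := (norm_nonneg _).trans hc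
  have hd0 : 0 ≤ d := (norm_nonneg _).trans hd
  have hbound : ∀ (T : X →L[ℂ] X) (e : ℝ), ‖T‖ ≤ e → ∀ i,
      ‖(rep i).1 (R (R (T (rep i).2)))‖ ≤ b * b * e * (‖(rep i).1‖ * ‖(rep i).2‖) := by
    intro T e hT i
    have he0 : 0 ≤ e := (norm_nonneg _).trans hT
    calc ‖(rep i).1 (R (R (T (rep i).2)))‖
        ≤ ‖(rep i).1‖ * (b * (b * (e * ‖(rep i).2‖))) := by
          refine (rep i).1.le_of_opNorm_le_of_le le_rfl (R.le_of_opNorm_le_of_le hb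
            (R.le_of_opNorm_le_of_le hb (T.le_of_opNorm_le hT _)))
      _ = _ := by ring
  have hsplit := hsum.summable.sum_add_tsum_nat_add n
  rw [hsum.tsum_eq] at hsplit
  have h1 : ∑ i ∈ Finset.range n, (rep i).1 (R (R (C' (rep i).2))) - s =
      ∑ i ∈ Finset.range n, (rep i).1 (R (R ((C' - C) (rep i).2))) -
        ∑' i, (rep (i + n)).1 (R (R (C (rep (i + n)).2))) := by
    rw [← hsplit]
    simp only [sub_apply, map_sub, Finset.sum_sub_distrib]
    ring
  rw [h1]
  refine (norm_sub_le _ _).trans (add_le_add ?_ ?_)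
  · refine (norm_sum_le_of_le _ fun i _ => hbound (C' - C) d hd i).trans ?_
    rw [← Finset.mul_sum]
    gcongr
    exact hs.sum_le_tsum _ fun i _ => by positivity
  · rw [← tsum_mul_left]
    exact tsum_of_norm_bounded (((summable_nat_add_iff n).2 hs).mul_left _).hasSum
      fun i => hbound C c hc (i + n)

theorem mainComponent_subset {A B : X →ₗ.[ℂ] X} : mainComponent B A ⊆ rho A ∩ rho B :=
  connectedComponentIn_subset _ _

theorem tendsto_partialOp {V : X →L[ℂ] X} {rep : ℕ → (X →L[ℂ] ℂ) × X} (hV : IsNuclearRep V rep) :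
    Filter.Tendsto (fun n => ‖partialOp rep n - V‖) Filter.atTop (nhds 0) :=
  tendsto_iff_norm_sub_tendsto_zero.1 hV.2.tendsto_sum_nat

theorem Ioi_subset_mainComponent {A B : X →ₗ.[ℂ] X} (hA : IsNonpositive A) (hB : IsNonpositive B) :
    ∀ t : ℝ, 0 < t → (t : ℂ) ∈ mainComponent B A := by
  have hpre : IsPreconnected ((fun t : ℝ => (t : ℂ)) '' Ioi 0) :=
    isPreconnected_Ioi.image _ Complex.continuous_ofReal.continuousOn
  intro t ht
  refine hpre.subset_connectedComponentIn ⟨1, mem_Ioi.2 one_pos, by simp⟩ ?_ ⟨t, ht, rfl⟩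
  rintro _ ⟨s, hs, rfl⟩
  exact ⟨hA.pos_mem_rho s hs, hB.pos_mem_rho s hs⟩

variable [CompleteSpace X]

/-- Stability of a right inverse of `1 + V R` under small perturbations of `V`. -/
theorem exists_right_inverse_near {V V' R C : X →L[ℂ] X} {b c : ℝ} (hC : (1 + V * R) * C = 1)
    (hb : ‖R‖ ≤ b) (hc : ‖C‖ ≤ c) (hsmall : ‖V' - V‖ * (b * c) ≤ 1 / 2) :
    ∃ C' : X →L[ℂ] X, (1 + V' * R) * C' = 1 ∧ ‖C' - C‖ ≤ c * (‖V' - V‖ * (b * c) * 2) := by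
  have hb0 : 0 ≤ b := (norm_nonneg _).trans hb
  have hc0 : 0 ≤ c := (norm_nonneg _).trans hc
  -- The defect: (1 + V'R) C = 1 + u with ‖u‖ ≤ 1/2, so C (1 + u)⁻¹ is a right inverse, and ‖(1 +
  -- u)⁻¹‖ ≤ 2.
  set u : X →L[ℂ] X := (V' - V) * (R * C) with hu
  have hun : ‖u‖ ≤ ‖V' - V‖ * (b * c) := by
    refine (norm_mul_le _ _).trans ?_
    gcongr
    exact (norm_mul_le _ _).trans (by gcongr)
  have hunit : IsUnit (1 + u) := by
    have := isUnit_one_sub_of_norm_lt_one (x := -u) (by rw [norm_neg]; linarith)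
    rwa [sub_neg_eq_add] at this
  set T := Ring.inverse (1 + u) with hT
  have hmul : (1 + u) * T = 1 := Ring.mul_inverse_cancel _ hunit
  have hTu : T - 1 = -(u * T) := by rw [← hmul]; noncomm_ring
  have hone : ‖(1 : X →L[ℂ] X)‖ ≤ 1 := ContinuousLinearMap.norm_id_le
  have hTn : ‖T‖ ≤ 2 := by
    have h1 : T = 1 + -(u * T) := by rw [← hTu]; abel
    have h2 : ‖T‖ ≤ 1 + ‖u‖ * ‖T‖ := by
      calc ‖T‖ = ‖1 + -(u * T)‖ := by rw [← h1]
        _ ≤ ‖(1 : X →L[ℂ] X)‖ + ‖-(u * T)‖ := norm_add_le _ _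
        _ ≤ 1 + ‖u‖ * ‖T‖ := by rw [norm_neg]; gcongr; exact norm_mul_le _ _
    nlinarith [norm_nonneg T, norm_nonneg u]
  refine ⟨C * T, ?_, ?_⟩
  · have h1 : (1 + V' * R) * C = 1 + u := by
      calc (1 + V' * R) * C = (1 + V * R) * C + (V' - V) * (R * C) := by noncomm_ring
        _ = 1 + u := by rw [hC]
    rw [← mul_assoc, h1, hmul]
  · have h1 : C * T - C = C * (T - 1) := by noncomm_ring
    rw [h1, hTu]
    refine (norm_mul_le _ _).trans ?_
    rw [norm_neg]
    gcongr
    exact (norm_mul_le _ _).trans (by gcongr)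

variable {A B : X →ₗ.[ℂ] X} {V : X →L[ℂ] X} {rep : ℕ → (X →L[ℂ] ℂ) × X} {z : ℂ}

theorem res_sub_res_of_perturbation_swap (hA : IsNonpositive A) (hB : IsNonpositive B)
    (hdom : A.domain ≤ B.domain)
    (hAB : ∀ x (hx : x ∈ A.domain), B ⟨x, hdom hx⟩ = A ⟨x, hx⟩ + V x)
    (hzA : z ∈ rho A) (hzB : z ∈ rho B) :
    res z B - res z A = res z A * V * res z B := by
  have hdom' : B.domain ≤ A.domain := (domain_eq_of_perturbation hA hB hdom hAB).ge
  have h := res_sub_res_of_perturbation (A := B) (B := A) (V := -V) hdom'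
    (fun x hx => by
      rw [hAB x (hdom' hx), neg_apply, add_neg_cancel_right]) hzB hzA
  rw [← neg_sub, h]
  noncomm_ring

/-- The difference of resolvents is also R(z, A) V R(z, B); written this way, its trace series has
the order R(z, B) R(z, A) that comes out of the finite determinants. -/
theorem hasSum_trace_resDiff (hAP : HasApproximationProperty X) (hA : IsNonpositive A)
    (hB : IsNonpositive B) (hdom : A.domain ≤ B.domain)
    (hAB : ∀ x (hx : x ∈ A.domain), B ⟨x, hdom hx⟩ = A ⟨x, hx⟩ + V x)
    (hV : IsNuclearRep V rep) (hzA : z ∈ rho A) (hzB : z ∈ rho B) :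
    HasSum (fun i => (rep i).1 (res z B (res z A (rep i).2)))
      (NuclearSpace.trace hAP (resDiff hV B A z)) := by
  have h : resDiff hV B A z = sandwich hV (res z A) (res z B) := by
    apply NuclearSpace.toOp_injective
    rw [resDiff, toOp_sandwich, toOp_sandwich, ← res_sub_res_of_perturbation hdom hAB hzA hzB,
      res_sub_res_of_perturbation_swap hA hB hdom hAB hzA hzB]
  rw [h]
  exact hasSum_trace_sandwich hAP hV _ _

theorem isOpen_mainComponent : IsOpen (mainComponent B A) :=
  (isOpen_rho.inter isOpen_rho).connectedComponentIn

/-- The logarithmic derivatives of the determinants of the finite rank approximations converge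
locally uniformly. -/
theorem eventually_logDeriv_det_near (hAP : HasApproximationProperty X) (hA : IsNonpositive A)
    (hB : IsNonpositive B) (hdom : A.domain ≤ B.domain)
    (hAB : ∀ x (hx : x ∈ A.domain), B ⟨x, hdom hx⟩ = A ⟨x, hx⟩ + V x)
    (hV : IsNuclearRep V rep) {K : Set ℂ} (hK : IsCompact K) (hKsub : K ⊆ rho A ∩ rho B)
    {ε : ℝ} (hε : 0 < ε) :
    ∀ᶠ n in Filter.atTop, ∀ w ∈ K,
      (1 + dyadMatrix rep n (res w B)).det ≠ 0 ∧
      ‖logDeriv (fun w => (1 + dyadMatrix rep n (res w B)).det) w -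
        -NuclearSpace.trace hAP (resDiff hV B A w)‖ ≤ ε := by
  have hcontA : ContinuousOn (fun w => 1 - V * res w A) K :=
    continuousOn_const.sub (continuousOn_const.mul
      (continuousOn_res.mono (hKsub.trans inter_subset_left)))
  obtain ⟨b, hb⟩ := hK.exists_bound_of_continuousOn
    (continuousOn_res.mono (hKsub.trans inter_subset_right))
  obtain ⟨c, hc⟩ := hK.exists_bound_of_continuousOn hcontA
  set S := ∑' i, ‖(rep i).1‖ * ‖(rep i).2‖ with hS
  have hlim1 : Filter.Tendsto (fun n => ‖partialOp rep n - V‖ * (b * c)) Filter.atTop (nhds 0) := by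
    simpa using (tendsto_partialOp hV).mul_const (b * c)
  have htail := tendsto_sum_nat_add fun i => ‖(rep i).1‖ * ‖(rep i).2‖
  have hlim2 : Filter.Tendsto (fun n => b * b * (c * (‖partialOp rep n - V‖ * (b * c) * 2)) * S +
      b * b * c * ∑' i, ‖(rep (i + n)).1‖ * ‖(rep (i + n)).2‖) Filter.atTop (nhds 0) := by
    have h1 := (((hlim1.mul_const 2).const_mul c).const_mul (b * b)).mul_const S
    have h2 := htail.const_mul (b * b * c)
    simpa using h1.add h2
  filter_upwards [hlim1.eventually_le_const (by norm_num : (0 : ℝ) < 1 / 2),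
    hlim2.eventually_le_const hε] with n hn1 hn2 w hw
  obtain ⟨hwA, hwB⟩ := hKsub hw
  have e1 := res_sub_res_of_perturbation hdom hAB hwA hwB
  -- So C = 1 - V R(w, A) satisfies R(w, B) C = R(w, A) and is a right inverse of 1 + V R(w, B). The
  -- limiting series ∑ fᵢ(R(w, B)² C xᵢ) thus becomes the trace of the difference of resolvents.
  have hRC : res w B * (1 - V * res w A) = res w A := by
    rw [mul_sub, mul_one, ← mul_assoc, ← e1, sub_sub_cancel]
  have hinv : (1 + V * res w B) * (1 - V * res w A) = 1 := by
    rw [add_mul, mul_assoc, hRC, one_mul, sub_add_cancel]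
  obtain ⟨C', hC', hd⟩ := exists_right_inverse_near (V' := partialOp rep n) hinv (hb w hw) (hc w hw) hn1
  obtain ⟨h0, hlog⟩ := logDeriv_det_one_add_dyadMatrix rep n (R := fun w => res w B) (z := w)
    (hasDerivAt_res hwB) hC'
  refine ⟨h0, ?_⟩
  rw [hlog, ← neg_sub', norm_neg]
  refine (norm_sum_range_sub_le hV.1 (hb w hw) (hc w hw) hd ?_ n).trans hn2
  have hsum := hasSum_trace_resDiff hAP hA hB hdom hAB hV hwA hwB
  refine hsum.congr_fun fun i => ?_
  have h2 := congrArg (fun T : X →L[ℂ] X => T (rep i).2) hRC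
  simp only [mul_apply_eq_comp] at h2
  rw [h2]

theorem exists_logarithmic_primitive (hAP : HasApproximationProperty X) (hA : IsNonpositive A)
    (hB : IsNonpositive B) (hdom : A.domain ≤ B.domain)
    (hAB : ∀ x (hx : x ∈ A.domain), B ⟨x, hdom hx⟩ = A ⟨x, hx⟩ + V x)
    (hV : IsNuclearRep V rep) :
    ∃ F : ℂ → ℂ, ∀ z ∈ mainComponent B A, F z ≠ 0 ∧
      HasDerivAt F (-NuclearSpace.trace hAP (resDiff hV B A z) * F z) z := by
  refine exists_continuation_of_logDeriv_tendsto (a := ((1 : ℝ) : ℂ))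
    (f := fun n w => (1 + dyadMatrix rep n (res w B)).det)
    (g := fun z => -NuclearSpace.trace hAP (resDiff hV B A z))
    isPreconnected_connectedComponentIn (Ioi_subset_mainComponent hA hB 1 one_pos) ?_ ?_ ?_
  · exact ((NuclearSpace.trace hAP).differentiable.comp_differentiableOn
      ((differentiableOn_resDiff hV).mono mainComponent_subset)).neg
  · intro n z hz
    exact (hasDerivAt_det (hasDerivAt_one_add_dyadMatrix rep n
      (hasDerivAt_res (mainComponent_subset hz).2))).differentiableAt.differentiableWithinAt
  · intro z hz
    obtain ⟨δ, hδ, hsub⟩ := Metric.nhds_basis_closedBall.mem_iff.1 (isOpen_mainComponent.mem_nhds hz)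
    refine ⟨δ, hδ, Metric.ball_subset_closedBall.trans hsub, fun ε hε => ?_⟩
    filter_upwards [eventually_logDeriv_det_near hAP hA hB hdom hAB hV
      (isCompact_closedBall z δ) (hsub.trans mainComponent_subset) hε] with n hn w hw
    exact hn w (Metric.ball_subset_closedBall hw)

/-- The analytic continuation of the perturbation determinant. -/
theorem exists_isContinuation (hAP : HasApproximationProperty X) (hA : IsNonpositive A)
    (hB : IsNonpositive B) (hdom : A.domain ≤ B.domain)
    (hAB : ∀ x (hx : x ∈ A.domain), B ⟨x, hdom hx⟩ = A ⟨x, hx⟩ + V x)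
    (hV : IsNuclearRep V rep) :
    ∃ F : ℂ → ℂ, IsContinuation B A F ∧ ∀ z ∈ mainComponent B A, F z ≠ 0 ∧
      HasDerivAt F (-NuclearSpace.trace hAP (resDiff hV B A z) * F z) z := by
  obtain ⟨F, hF⟩ := exists_logarithmic_primitive hAP hA hB hdom hAB hV
  set g : ℝ → ℂ := fun t => NuclearSpace.trace hAP (resDiff hV B A (t : ℂ)) with hg
  have hgi : ∀ l : ℝ, 0 < l → IntegrableOn g (Ioi l) := fun l hl =>
    (NuclearSpace.trace hAP).integrable_comp (integrableOn_resDiff hA hB hV hl)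
  have hgc : ContinuousOn g (Ioi 0) :=
    (NuclearSpace.trace hAP).continuous.comp_continuousOn
      ((differentiableOn_resDiff hV).continuousOn.comp Complex.continuous_ofReal.continuousOn
        fun t ht => ⟨hA.pos_mem_rho t ht, hB.pos_mem_rho t ht⟩)
  have hderiv : ∀ l : ℝ, 0 < l → HasDerivAt (fun l : ℝ => ∫ t in Ioi l, g t) (-g l) l := by
    intro l hl
    have hl2 : 0 < l / 2 := by positivity
    -- The base point l/2 turns the tail integral near l into a constant minus an integral over a
    -- bounded interval.
    have hint : ∀ a, l / 2 ≤ a → IntervalIntegrable g volume (l / 2) a := fun a ha =>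
      (intervalIntegrable_iff_integrableOn_Ioc_of_le ha).2
        ((hgi _ hl2).mono_set Ioc_subset_Ioi_self)
    have hmeas : StronglyMeasurableAtFilter g (nhds l) volume :=
      hgc.stronglyMeasurableAtFilter isOpen_Ioi l hl
    have h1 := intervalIntegral.integral_hasDerivAt_right (hint l (by linarith)) hmeas
      (hgc.continuousAt (Ioi_mem_nhds hl))
    have h2 := (h1.const_sub (∫ t in Ioi (l / 2), g t))
    refine h2.congr_of_eventuallyEq ?_
    filter_upwards [Ioi_mem_nhds (show l / 2 < l by linarith)] with a ha
    have h3 := intervalIntegral.integral_Ioi_sub_Ioi (hgi _ hl2) (le_of_lt ha)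
    rw [← h3, sub_sub_cancel]
  -- Both factors have logarithmic derivatives -g and g, so the product is constant on the
  -- half-line; dividing F by this constant normalises it to Δ.
  have hconst : ∀ l : ℝ, 0 < l → F l * Complex.exp (-∫ t in Ioi l, g t) =
      F (1 : ℝ) * Complex.exp (-∫ t in Ioi (1 : ℝ), g t) := by
    have hd : ∀ l : ℝ, 0 < l →
        HasDerivAt (fun l : ℝ => F l * Complex.exp (-∫ t in Ioi l, g t)) 0 l := fun l hl => by
      have h1 := ((hF l (Ioi_subset_mainComponent hA hB l hl)).2.comp_ofReal).mul
        (hderiv l hl).neg.cexp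
      refine h1.congr_deriv ?_
      simp only [hg]
      ring
    intro l hl
    refine (convex_Ioi (0 : ℝ)).is_const_of_fderivWithin_eq_zero (𝕜 := ℝ)
      (f := fun l : ℝ => F l * Complex.exp (-∫ t in Ioi l, g t))
      (fun v hv => (hd v hv).differentiableAt.differentiableWithinAt)
      (fun v hv => ?_) hl (mem_Ioi.2 one_pos)
    rw [fderivWithin_of_isOpen isOpen_Ioi hv]
    ext
    simp [(hd v hv).deriv]
  set κ := F (1 : ℝ) * Complex.exp (-∫ t in Ioi (1 : ℝ), g t) with hκ
  have hκ0 : κ ≠ 0 := mul_ne_zero (hF _ (Ioi_subset_mainComponent hA hB 1 one_pos)).1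
    (Complex.exp_ne_zero _)
  have hd : ∀ z ∈ mainComponent B A,
      HasDerivAt (fun z => κ⁻¹ * F z) (-NuclearSpace.trace hAP (resDiff hV B A z) * (κ⁻¹ * F z)) z :=
    fun z hz => ((hF z hz).2.const_mul κ⁻¹).congr_deriv (by ring)
  refine ⟨fun z => κ⁻¹ * F z, ⟨?_, fun l hl => ?_⟩, fun z hz =>
    ⟨mul_ne_zero (inv_ne_zero hκ0) (hF z hz).1, hd z hz⟩⟩
  · exact DifferentiableOn.analyticOnNhd
      (fun z hz => (hd z hz).differentiableAt.differentiableWithinAt) isOpen_mainComponent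
  · rw [pertDet_eq_exp_integral hAP hA hB hdom hAB hV hl, inv_mul_eq_iff_eq_mul₀ hκ0, ← hconst l hl,
      mul_assoc, ← Complex.exp_add, neg_add_cancel, Complex.exp_zero, mul_one]

end Determinant

/-! ### Behaviour near a point of finite multiplicity -/

section Local

/-- Polar coordinates present the punctured disc as a continuous image of (0, r) × ℝ. -/
theorem isPreconnected_ball_diff_singleton (z : ℂ) (r : ℝ) :
    IsPreconnected (Metric.ball z r \ {z}) := by
  have h : Metric.ball z r \ {z} =
      (fun p : ℝ × ℝ => z + p.1 * Complex.exp (p.2 * Complex.I)) '' (Ioo 0 r ×ˢ univ) := by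
    ext w
    constructor
    · rintro ⟨hw, hne⟩
      refine ⟨(‖w - z‖, Complex.arg (w - z)), ⟨⟨norm_pos_iff.2 (sub_ne_zero.2 hne), ?_⟩, mem_univ _⟩, ?_⟩
      · simpa [dist_eq_norm] using hw
      · simp only [Complex.norm_mul_exp_arg_mul_I, add_sub_cancel]
    · rintro ⟨⟨ρ, θ⟩, ⟨⟨hρ, hρr⟩, -⟩, rfl⟩
      have hn : ‖(ρ : ℂ) * Complex.exp (θ * Complex.I)‖ = ρ := by
        rw [norm_mul, Complex.norm_exp_ofReal_mul_I, mul_one, Complex.norm_real,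
          Real.norm_of_nonneg hρ.le]
      refine ⟨?_, fun h' => ?_⟩
      · rw [Metric.mem_ball, dist_eq_norm, add_sub_cancel_left, hn]
        exact hρr
      · have h0 : (ρ : ℂ) * Complex.exp (θ * Complex.I) = 0 := by simpa using h'
        rw [h0, norm_zero] at hn
        exact hρ.ne hn
  rw [h]
  exact (isPreconnected_Ioo.prod isPreconnected_univ).image _ (by fun_prop)

theorem meromorphicAt_clm_apply₂ {E F G : Type*} [NormedAddCommGroup E] [NormedSpace ℂ E]
    [NormedAddCommGroup F] [NormedSpace ℂ F] [NormedAddCommGroup G] [NormedSpace ℂ G]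
    (b : E →L[ℂ] F →L[ℂ] G) {f : ℂ → E} {g : ℂ → F} {z : ℂ} (hf : MeromorphicAt f z)
    (hg : MeromorphicAt g z) : MeromorphicAt (fun w => b (f w) (g w)) z := by
  obtain ⟨m, hm⟩ := hf
  obtain ⟨n, hn⟩ := hg
  refine ⟨m + n, ?_⟩
  refine ((b.analyticAt_bilinear _).comp (hm.prod hn)).congr
    (Filter.Eventually.of_forall fun w => ?_)
  simp only [Function.comp_apply, map_smul, smul_apply, smul_smul, pow_add, mul_comm]

/-- A meromorphic function that becomes analytic after an injective bounded linear map is itself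
analytic up to a removable singularity. -/
theorem exists_analyticAt_of_clm_comp {E F : Type*} [NormedAddCommGroup E] [NormedSpace ℂ E]
    [NormedAddCommGroup F] [NormedSpace ℂ F] (J : E →L[ℂ] F) (hJ : Function.Injective J)
    {f : ℂ → E} {h : ℂ → F} {z : ℂ} (hf : MeromorphicAt f z) (hh : ContinuousAt h z)
    (heq : ∀ᶠ w in nhdsWithin z {z}ᶜ, J (f w) = h w) :
    ∃ m : ℂ → E, AnalyticAt ℂ m z ∧ ∀ᶠ w in nhdsWithin z {z}ᶜ, f w = m w := by
  rcases h0 : meromorphicOrderAt f z with _ | p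
  · exact ⟨0, analyticAt_const, meromorphicOrderAt_eq_top_iff.1 h0⟩
  obtain ⟨g, hg, hg0, hfg⟩ := (meromorphicOrderAt_eq_int_iff hf).1 h0
  rcases le_or_gt 0 p with hp | hp
  · lift p to ℕ using hp
    refine ⟨fun w => (w - z) ^ p • g w, by fun_prop, ?_⟩
    simpa using hfg
  · exfalso
    obtain ⟨q, hq, rfl⟩ : ∃ q : ℕ, 0 < q ∧ p = -(q : ℤ) :=
      ⟨p.natAbs, by omega, by omega⟩
    -- At a pole of order q, (w - z)^q h(w) tends to 0 by continuity of h, yet it equals J (g w),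
    -- whose limit J (g z) is nonzero by injectivity.
    have h1 : ∀ᶠ w in nhdsWithin z {z}ᶜ, (w - z) ^ q • h w = J (g w) := by
      filter_upwards [hfg, heq, self_mem_nhdsWithin] with w hw1 hw2 hw3
      rw [← hw2, hw1, map_smul, smul_smul, zpow_neg, zpow_natCast, mul_inv_cancel₀, one_smul]
      exact pow_ne_zero _ (sub_ne_zero.2 hw3)
    have h2 : Filter.Tendsto (fun w => (w - z) ^ q • h w) (nhdsWithin z {z}ᶜ) (nhds 0) := by
      have : ContinuousAt (fun w => (w - z) ^ q • h w) z :=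
        (by fun_prop : ContinuousAt (fun w : ℂ => (w - z) ^ q) z).smul hh
      have := this.tendsto.mono_left (nhdsWithin_le_nhds (s := {z}ᶜ))
      simpa [hq.ne'] using this
    have h3 : Filter.Tendsto (fun w => J (g w)) (nhdsWithin z {z}ᶜ) (nhds (J (g z))) :=
      ((J.continuous.tendsto _).comp hg.continuousAt.tendsto).mono_left nhdsWithin_le_nhds
    have h4 := tendsto_nhds_unique h3 (h2.congr' h1)
    exact hg0 (hJ (h4.trans (map_zero J).symm))

/-- A function whose logarithmic derivative has a simple pole with integral residue. -/
theorem meromorphicOrderAt_of_logDeriv {F h : ℂ → ℂ} {z : ℂ} {m : ℤ} (hh : AnalyticAt ℂ h z)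
    (hF : ∀ᶠ w in nhdsWithin z {z}ᶜ,
      F w ≠ 0 ∧ HasDerivAt F ((m * (w - z)⁻¹ - h w) * F w) w) :
    MeromorphicAt F z ∧ meromorphicOrderAt F z = (m : WithTop ℤ) := by
  obtain ⟨r, hr, hr1⟩ := Metric.eventually_nhds_iff_ball.1
    (hh.eventually_analyticAt.and (eventually_nhdsWithin_iff.1 hF))
  have hhd : DifferentiableOn ℂ h (Metric.ball z r) :=
    fun w hw => (hr1 w hw).1.differentiableAt.differentiableWithinAt
  obtain ⟨p, hp⟩ := hhd.isExactOn_ball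
  have hpan : AnalyticAt ℂ p z :=
    DifferentiableOn.analyticAt
      (fun w hw => (hp w hw).differentiableAt.differentiableWithinAt) (Metric.ball_mem_nhds z hr)
  have hopen : IsOpen (Metric.ball z r \ {z}) := Metric.isOpen_ball.sdiff isClosed_singleton
  -- With p' = h the product has zero derivative, hence is constant on the connected punctured disc.
  let Q : ℂ → ℂ := fun w => F w * ((w - z) ^ (-m) * Complex.exp (p w))
  have hQ : ∀ w ∈ Metric.ball z r \ {z}, HasDerivAt Q 0 w := fun w hw => by
    have hne : w - z ≠ 0 := sub_ne_zero.2 hw.2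
    have h1 := ((hr1 w hw.1).2 hw.2).2
    have h2 : HasDerivAt (fun w => (w - z) ^ (-m)) ((-m : ℤ) * (w - z) ^ (-m - 1)) w := by
      simpa using (hasDerivAt_zpow (-m) (w - z) (Or.inl hne)).comp_sub_const w z
    refine (h1.mul (h2.mul (hp w hw.1).cexp)).congr_deriv ?_
    rw [zpow_sub_one₀ hne]
    push_cast
    simp only [Pi.mul_apply]
    ring
  obtain ⟨c, hc⟩ := hopen.exists_is_const_of_deriv_eq_zero (isPreconnected_ball_diff_singleton z r)
    (fun w hw => (hQ w hw).differentiableAt.differentiableWithinAt) (fun w hw => (hQ w hw).deriv)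
  have hFeq : ∀ w ∈ Metric.ball z r \ {z}, F w = (w - z) ^ m • (c * Complex.exp (-p w)) :=
    fun w hw => by
      have hne : w - z ≠ 0 := sub_ne_zero.2 hw.2
      rw [← hc w hw, smul_eq_mul, Complex.exp_neg]
      simp only [Q]
      rw [zpow_neg]
      field_simp [zpow_ne_zero m hne]
  have hc0 : c ≠ 0 := by
    obtain ⟨w, hw, hw'⟩ : ∃ w ∈ Metric.ball z r, w ≠ z :=
      ⟨z + (r / 2 : ℝ), by simp [abs_of_pos hr, hr], by simp [hr.ne']⟩
    intro h0
    refine ((hr1 w hw).2 hw').1 ?_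
    rw [hFeq w ⟨hw, hw'⟩, h0, zero_mul, smul_zero]
  have hev : ∀ᶠ w in nhdsWithin z {z}ᶜ, F w = (w - z) ^ m • (c * Complex.exp (-p w)) := by
    filter_upwards [self_mem_nhdsWithin, mem_nhdsWithin_of_mem_nhds (Metric.ball_mem_nhds z hr)]
      with w hw hw'
    exact hFeq w ⟨hw', hw⟩
  have han : AnalyticAt ℂ (fun w => c * Complex.exp (-p w)) z :=
    analyticAt_const.mul hpan.neg.cexp
  have hmer : MeromorphicAt F z := by
    refine MeromorphicAt.congr (f := fun w => (w - z) ^ m • (c * Complex.exp (-p w))) ?_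
      (hev.mono fun w hw => hw.symm)
    exact ((MeromorphicAt.id z).sub (MeromorphicAt.const z z)).zpow m |>.smul han.meromorphicAt
  exact ⟨hmer, (meromorphicOrderAt_eq_int_iff hmer).2
    ⟨_, han, mul_ne_zero hc0 (Complex.exp_ne_zero _), hev⟩⟩

/-- The identity theorem, applied at 1, where the half-line accumulates. -/
theorem IsContinuation.eqOn {X : Type*} [NormedAddCommGroup X] [NormedSpace ℂ X]
    {A B : X →ₗ.[ℂ] X} (hA : IsNonpositive A) (hB : IsNonpositive B) {F G : ℂ → ℂ}
    (hF : IsContinuation B A F) (hG : IsContinuation B A G) : EqOn F G (mainComponent B A) := by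
  refine hF.1.eqOn_of_preconnected_of_frequently_eq hG.1 isPreconnected_connectedComponentIn
    (Ioi_subset_mainComponent hA hB 1 one_pos) ?_
  have hreal : ∃ᶠ t : ℝ in nhdsWithin 1 {1}ᶜ, F (t : ℂ) = G (t : ℂ) := by
    refine Filter.Eventually.frequently ?_
    filter_upwards [mem_nhdsWithin_of_mem_nhds (Ioi_mem_nhds (zero_lt_one' ℝ))] with t ht
    rw [hF.2 t ht, hG.2 t ht]
  refine Filter.Tendsto.frequently (f := fun t : ℝ => (t : ℂ)) ?_ hreal
  refine tendsto_nhdsWithin_of_tendsto_nhds_of_eventually_within _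
    (Complex.continuous_ofReal.continuousAt.tendsto.mono_left nhdsWithin_le_nhds) ?_
  filter_upwards [self_mem_nhdsWithin] with t ht
  simpa using ht

variable {X : Type*} [NormedAddCommGroup X] [NormedSpace ℂ X] [CompleteSpace X]
  {A B : X →ₗ.[ℂ] X} {V : X →L[ℂ] X} {rep : ℕ → (X →L[ℂ] ℂ) × X} {z : ℂ}

/-- The principal part of the resolvent at a point of finite multiplicity `k` is nuclear, with
trace `k / (w - z)`. -/
theorem HasAlgMultiplicity.exists_principalPart (hAP : HasApproximationProperty X)
    (hnil : ∀ N : X →L[ℂ] X, IsNuclear N → IsNilpotent N → nuclearTrace N = 0) {k : ℕ}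
    (h : HasAlgMultiplicity A z k) :
    ∃ (S : ℂ → NuclearSpace X) (H : ℂ → X →L[ℂ] X), MeromorphicAt S z ∧ AnalyticAt ℂ H z ∧
      ∀ᶠ w in nhdsWithin z {z}ᶜ, w ∈ rho A ∧ res w A = (S w).toOp + H w ∧
        NuclearSpace.trace hAP (S w) = k * (w - z)⁻¹ := by
  rcases h with ⟨hz, rfl⟩ | h
  · refine ⟨0, fun w => res w A, analyticAt_const.meromorphicAt,
      differentiableOn_res.analyticAt (isOpen_rho.mem_nhds hz), ?_⟩
    filter_upwards [mem_nhdsWithin_of_mem_nhds (isOpen_rho.mem_nhds hz)] with w hw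
    exact ⟨hw, by simp, by simp⟩
  obtain ⟨P, D, n, H, hP, hfin, hk, ⟨q, hD⟩, hDP, hPD, hH, hev⟩ := h.exists_laurent
  -- For j = 0 the coefficient is the projection P, of trace k; for j > 0 it is a power of D,
  -- nilpotent, and `hnil` makes its trace vanish.
  have hex : ∀ j : ℕ, ∃ T : NuclearSpace X, T.toOp = D ^ j * P ∧
      NuclearSpace.trace hAP T = if j = 0 then (k : ℂ) else 0 := by
    intro j
    rcases j with _ | j
    · obtain ⟨T, hT, hT'⟩ := exists_toOp_eq_of_finiteDimensional_range hAP P hfin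
      exact ⟨T, by simpa using hT, by simp [hT' hP, hk]⟩
    · have hPDj : P * (D ^ (j + 1) * P) = D ^ (j + 1) * P := by
        rw [pow_succ', ← mul_assoc, ← mul_assoc, hPD]
      have hDjP : D ^ (j + 1) * P = D ^ (j + 1) := by rw [pow_succ, mul_assoc, hDP]
      have hle : (D ^ (j + 1) * P).range ≤ P.range := by
        rintro _ ⟨x, rfl⟩
        exact ⟨(D ^ (j + 1) * P) x, congrArg (fun T : X →L[ℂ] X => T x) hPDj⟩
      obtain ⟨T, hT, -⟩ := exists_toOp_eq_of_finiteDimensional_range hAP (D ^ (j + 1) * P)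
        (Submodule.finiteDimensional_of_le hle)
      refine ⟨T, hT, ?_⟩
      have hN : IsNilpotent T.toOp := by
        rw [hT, hDjP]
        exact ⟨q, by rw [← pow_mul, mul_comm, pow_mul, hD, zero_pow (Nat.succ_ne_zero j)]⟩
      rw [← nuclearTrace_toOp hAP, hnil _ (isNuclear_toOp T) hN, if_neg (Nat.succ_ne_zero j)]
  choose T hT hTtr using hex
  refine ⟨fun w => ∑ j ∈ Finset.range (n + 1), ((w - z) ^ (j + 1))⁻¹ • T j, H, ?_, hH, ?_⟩
  · refine MeromorphicAt.fun_sum fun j _ => ?_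
    exact ((((MeromorphicAt.id z).sub (MeromorphicAt.const z z)).pow (j + 1)).inv).smul
      (MeromorphicAt.const (T j) z)
  · filter_upwards [hev] with w hw
    refine ⟨hw.1, ?_, ?_⟩
    · rw [hw.2]
      simp only [map_sum, map_smul, hT]
    · simp only [map_sum, map_smul, hTtr]
      rw [Finset.sum_eq_single_of_mem 0 (by simp) (fun j _ hj => by simp [hj])]
      simp [mul_comm]

/-- The trace of `R(w, B) - R(w, A)` near a point of finite multiplicity. -/
theorem exists_trace_resDiff_eq (hAP : HasApproximationProperty X)
    (hnil : ∀ N : X →L[ℂ] X, IsNuclear N → IsNilpotent N → nuclearTrace N = 0)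
    (hdom : A.domain ≤ B.domain)
    (hAB : ∀ x (hx : x ∈ A.domain), B ⟨x, hdom hx⟩ = A ⟨x, hx⟩ + V x)
    (hV : IsNuclearRep V rep) {k₀ k : ℕ} (hk₀ : HasAlgMultiplicity B z k₀)
    (hk : HasAlgMultiplicity A z k) :
    ∃ h : ℂ → ℂ, AnalyticAt ℂ h z ∧ ∀ᶠ w in nhdsWithin z {z}ᶜ, w ∈ rho A ∩ rho B ∧
      NuclearSpace.trace hAP (resDiff hV B A w) = (k₀ - k) * (w - z)⁻¹ + h w := by
  obtain ⟨SA, HA, hSA, hHA, hevA⟩ := hk.exists_principalPart hAP hnil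
  obtain ⟨SB, HB, hSB, hHB, hevB⟩ := hk₀.exists_principalPart hAP hnil
  have hres : ∀ {C : X →ₗ.[ℂ] X} {S : ℂ → NuclearSpace X} {H : ℂ → X →L[ℂ] X},
      MeromorphicAt S z → AnalyticAt ℂ H z →
      (∀ᶠ w in nhdsWithin z {z}ᶜ, res w C = (S w).toOp + H w) →
      MeromorphicAt (fun w => res w C) z := by
    intro C S H hS hH hev
    refine MeromorphicAt.congr (f := fun w => (S w).toOp + H w) ?_ (hev.mono fun w hw => hw.symm)
    refine MeromorphicAt.fun_add ?_ hH.meromorphicAt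
    obtain ⟨m, hm⟩ := hS
    refine ⟨m, ((NuclearSpace.toOp.analyticAt _).comp hm).congr (Filter.Eventually.of_forall fun w => ?_)⟩
    simp
  have hmA := hres hSA hHA (hevA.mono fun w hw => hw.2.1)
  have hmB := hres hSB hHB (hevB.mono fun w hw => hw.2.1)
  have hmD : MeromorphicAt (resDiff hV B A) z := meromorphicAt_clm_apply₂ (sandwich hV) hmB hmA
  -- After removal of the principal parts, the corresponding operator is HB - HA, analytic in
  -- operator norm. Analyticity in the nuclear space is needed to take traces, and meromorphy there
  -- together with injectivity of `toOp` supplies it.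
  have hmn : MeromorphicAt (fun w => resDiff hV B A w - SB w + SA w) z :=
    (hmD.fun_sub hSB).fun_add hSA
  obtain ⟨m, hm, hmeq⟩ := exists_analyticAt_of_clm_comp NuclearSpace.toOp
    NuclearSpace.toOp_injective (h := fun w => HB w - HA w) hmn
    (hHB.continuousAt.sub hHA.continuousAt) (by
      filter_upwards [hevA, hevB] with w hwA hwB
      rw [map_add, map_sub, resDiff, toOp_sandwich,
        ← res_sub_res_of_perturbation hdom hAB hwA.1 hwB.1, hwA.2.1, hwB.2.1]
      abel)
  refine ⟨fun w => NuclearSpace.trace hAP (m w), ((NuclearSpace.trace hAP).analyticAt _).comp hm, ?_⟩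
  filter_upwards [hevA, hevB, hmeq] with w hwA hwB hw
  refine ⟨⟨hwA.1, hwB.1⟩, ?_⟩
  rw [← hw, map_add, map_sub, hwA.2.2, hwB.2.2]
  ring

/-- A punctured neighbourhood in `ρ(A) ∩ ρ(B)` of a point of the closure of the main component
belongs to the main component. -/
theorem eventually_mem_mainComponent (hz : z ∈ closure (mainComponent B A))
    (hev : ∀ᶠ w in nhdsWithin z {z}ᶜ, w ∈ rho A ∩ rho B) :
    ∀ᶠ w in nhdsWithin z {z}ᶜ, w ∈ mainComponent B A := by
  obtain ⟨r, hr, hsub⟩ := Metric.eventually_nhds_iff_ball.1 (eventually_nhdsWithin_iff.1 hev)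
  have hsub' : Metric.ball z r \ {z} ⊆ rho A ∩ rho B := fun w hw => hsub w hw.1 hw.2
  -- One point of the component in the punctured disc suffices, as the latter is connected. If the
  -- closure yields only the centre, openness of the component provides another point.
  obtain ⟨y, hy, hyΩ⟩ : ∃ y ∈ Metric.ball z r \ {z}, y ∈ mainComponent B A := by
    obtain ⟨y, hyb, hy⟩ := mem_closure_iff.1 hz _ Metric.isOpen_ball (Metric.mem_ball_self hr)
    by_cases hyz : y = z
    · subst hyz
      have hnhds : Metric.ball y r ∩ mainComponent B A ∈ nhds y :=
        Filter.inter_mem (Metric.ball_mem_nhds y hr) (isOpen_mainComponent.mem_nhds hy)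
      obtain ⟨x, hx⟩ := (Filter.Eventually.and (mem_nhdsWithin_of_mem_nhds hnhds)
        (self_mem_nhdsWithin (a := y) (s := {y}ᶜ))).exists
      exact ⟨x, ⟨hx.1.1, hx.2⟩, hx.1.2⟩
    · exact ⟨y, ⟨hyb, hyz⟩, hy⟩
  have hincl : Metric.ball z r \ {z} ⊆ mainComponent B A := by
    have h1 := (isPreconnected_ball_diff_singleton z r).subset_connectedComponentIn hy hsub'
    rw [mainComponent, connectedComponentIn_eq hyΩ]
    exact h1
  filter_upwards [self_mem_nhdsWithin, mem_nhdsWithin_of_mem_nhds (Metric.ball_mem_nhds z hr)]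
    with w hw hw'
  exact hincl ⟨hw', hw⟩

end Local

end PertDet

end

/-! ### The order of the continuation at z₁ -/

theorem corollary2 {X : Type*} [NormedAddCommGroup X] [NormedSpace ℂ X] [CompleteSpace X]
    (hAP : PertDet.HasApproximationProperty X)
    (A B : X →ₗ.[ℂ] X) (hA : PertDet.IsNonpositive A) (hB : PertDet.IsNonpositive B)
    (hne : A ≠ B) (hdom : A.domain ≤ B.domain) (hnuc : PertDet.IsNuclearPMap (B - A))
    (hnil : ∀ N : X →L[ℂ] X, PertDet.IsNuclear N → IsNilpotent N → PertDet.nuclearTrace N = 0)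
    (z₁ : ℂ) (k₀ k : ℕ)
    (hk₀ : PertDet.HasAlgMultiplicity B z₁ k₀) (hk : PertDet.HasAlgMultiplicity A z₁ k)
    (hz₁ : z₁ ∈ closure (PertDet.mainComponent B A)) :
    (∃ F : ℂ → ℂ, PertDet.IsContinuation B A F) ∧
      ∀ F : ℂ → ℂ, PertDet.IsContinuation B A F →
        MeromorphicAt F z₁ ∧ meromorphicOrderAt F z₁ = (((k : ℤ) - (k₀ : ℤ) : ℤ) : WithTop ℤ) := by
  obtain ⟨V, hVext, rep, hV⟩ := hnuc
  have hAB : ∀ x (hx : x ∈ A.domain), B ⟨x, hdom hx⟩ = A ⟨x, hx⟩ + V x := fun x hx => by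
    have h := hVext.2 ⟨x, hdom hx, hx⟩
    rw [LinearPMap.sub_apply] at h
    exact (add_eq_of_eq_sub' h).symm
  obtain ⟨F₀, hF₀, hlog⟩ := PertDet.exists_isContinuation hAP hA hB hdom hAB hV
  refine ⟨⟨F₀, hF₀⟩, fun F hF => ?_⟩
  have heq := hF.eqOn hA hB hF₀
  obtain ⟨h, hh, hev⟩ := PertDet.exists_trace_resDiff_eq hAP hnil hdom hAB hV hk₀ hk
  refine PertDet.meromorphicOrderAt_of_logDeriv hh ?_
  filter_upwards [hev, PertDet.eventually_mem_mainComponent hz₁ (hev.mono fun w hw => hw.1)]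
    with w hw hwΩ
  obtain ⟨hne, hd⟩ := hlog w hwΩ
  rw [heq hwΩ]
  refine ⟨hne, (hd.congr_of_eventuallyEq (heq.eventuallyEq_of_mem
    (PertDet.isOpen_mainComponent.mem_nhds hwΩ))).congr_deriv ?_⟩
  rw [hw.2]
  push_cast
  ring
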